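/- Let $\lambda$ be a Dyck path of length $2n$, i.e. a lattice path from $(0,0)$ to $(2n,0)$ with steps $U=(1,1)$ and $D=(1,-1)$ that never goes below $y=0$; we also write $\lambda$ for its word in $U,D$. *Dyck tilings.* For a Dyck path $\mu$ of length $2n$ lying weakly above $\lambda$, let $\lambda/\mu$ be the region between $\lambda$ (the lower path) and $\mu$ (the upper path), divided into boxes with side vectors $(1,1)$ and $(1,-1)$. A *Dyck tile* is a ribbon (a skew shape containing no $2\times2$ block of boxes) such that the centres of its boxes form a translate of a Dyck path; the empty path is allowed and gives a single box. A tiling $D$ of $\lambda/\mu$ by Dyck tiles is *cover-inclusive* if each tile, translated downward by one box (by $(0,-2)$ in these coordinates), either lies strictly below $\lambda$ or is contained in another tile of $D$. Let $\mathcal D(\lambda/\ast)$ be the set of cover-inclusive Dyck tilings of $\lambda/\mu$ for all such $\mu$, and for $D\in\mathcal D(\lambda/\ast)$ let $\mathrm{art}(D)=\tfrac12\bigl(\mathrm{area}(D)+\mathrm{tiles}(D)\bigr)$, where $\mathrm{area}(D)$ is the number of boxes of the tiled region and $\mathrm{tiles}(D)$ is the number of tiles of $D$. *Labellings.* Let $A(\lambda)$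 be the plane tree defined recursively as follows: $A(\emptyset)$ is a single root; for Dyck words $z,z'$, the tree $A(zz')$ is obtained by joining $A(z)$ and $A(z')$ at their roots, with $A(z')$ to the right, and $A(UzD)$ is obtained by attaching an edge just above the root of $A(z)$. The edges connected to leaves correspond to the consecutive letters $UD$ in $\lambda$. Let $\lambda_0$ be a word of length $2n$ in $U,D$ that lies weakly above $\lambda$. The *capacity* of a leaf edge with respect to $\lambda_0$ is the number of letters $U$ in the prefix of $\lambda_0$ that ends at the position of the $U$ of the corresponding $UD$, minus the number of letters $U$ in the prefix of $\lambda$ of the same length. A *labelling of Lascoux--Schützenberger type* of $A(\lambda/\lambda_0)$ assigns a non-negative integer to each edge of $A(\lambda)$ such that the integers are non-increasing from the leaves to the root and the integer on each leaf edge is at most its capacity. For such a labelling $\nu$ let $\sigma(\nu)$ be the sum of its integers, and let $P_{\lambda,\lambda_0}:=\sum_\nu q^{\sigma(\nu)}$, the sum over all such labellings. **Theorem.** For every Dyck path $\lambda$ of length $2n$, with $\lambda_0=U^{2n}$, $$\sum_{D\in\mathcal D(\lambda/\ast)}q^{\mathrm{art}(D)}=P_{\lambda,\lambda_0}$$ as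 polynomials in $q$. -/

import Mathlib

namespace DyckKL

open DyckStep

/-! ### Dyck paths

A Dyck path is Mathlib's `DyckWord`; its length is `2 * semilength`. -/

/-- The ordinate of the lattice path `w` after its first `i` steps, where `U = (1,1)` and
`D = (1,-1)`. -/
def height (w : DyckWord) (i : ℕ) : ℤ :=
  ((w.toList.take i).count U : ℤ) - ((w.toList.take i).count D : ℤ)

/-- The path `lo` lies weakly below the path `up`, so that the skew shape `lo / up` exists. -/
def LiesBelow (lo up : DyckWord) : Prop :=
  lo.semilength = up.semilength ∧ ∀ i, height lo i ≤ height up i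

/-! ### Dyck tilings -/

/-- A box is a unit box of the lattice rotated by 45 degrees, with side vectors `(1,1)` and
`(1,-1)`. It is represented by its centre `(x, y)`; its lowest and highest points are
`(x, y - 1)` and `(x, y + 1)`. -/
abbrev Box : Type := ℕ × ℤ

/-- The boxes of the skew shape between the lower path `lo` and the upper path `up`: the boxes
whose lowest point is on or above `lo` and whose highest point is on or below `up`. -/
noncomputable def skewShape (lo up : DyckWord) : Finset Box :=
  (Finset.range (2 * lo.semilength + 1)).biUnion fun x =>
    ((Finset.Ioo (height lo x) (height up x)).filter fun y => Odd (y - height lo x)).image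
      fun y => (x, y)

/-- A Dyck tile: a ribbon such that the centres of its boxes form a Dyck path `w` (translated by
a vector `(a, b)`). A single box is the case where `w` is empty. -/
def IsDyckTile (t : Finset Box) : Prop :=
  ∃ (w : DyckWord) (a : ℕ) (b : ℤ),
    t = (Finset.range (2 * w.semilength + 1)).image fun i => (a + i, b + height w i)

/-- The translate of a tile downward by one box, i.e. by the vector `(0, -2)` in the coordinates
in which `U = (1,1)` and `D = (1,-1)`. -/
def shiftDown (t : Finset Box) : Finset Box :=
  t.image fun p => (p.1, p.2 - 2)

/-- `T` is a tiling of the skew shape `lo / up` by Dyck tiles. -/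
structure IsDyckTiling (lo up : DyckWord) (T : Finset (Finset Box)) : Prop where
  below : LiesBelow lo up
  tile : ∀ t ∈ T, IsDyckTile t
  disjoint : (T : Set (Finset Box)).PairwiseDisjoint id
  cover : T.biUnion id = skewShape lo up

/-- Cover-inclusiveness: each tile, translated downward, is either strictly below the lower path
or contained in another tile. -/
def IsCoverInclusive (lo : DyckWord) (T : Finset (Finset Box)) : Prop :=
  ∀ t ∈ T, (∀ p ∈ shiftDown t, p.2 < height lo p.1) ∨ ∃ s ∈ T, s ≠ t ∧ shiftDown t ⊆ s

open Classical in
/-- The set `𝒟(lo / up)` of cover-inclusive Dyck tilings of the skew shape `lo / up`. (The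
tiles are sets of boxes of the skew shape, whence the ambient double power set.) -/
noncomputable def tilings (lo up : DyckWord) : Finset (Finset (Finset Box)) :=
  (skewShape lo up).powerset.powerset.filter fun T =>
    IsDyckTiling lo up T ∧ IsCoverInclusive lo T

theorem mem_tilings {lo up : DyckWord} {T : Finset (Finset Box)} :
    T ∈ tilings lo up ↔ IsDyckTiling lo up T ∧ IsCoverInclusive lo T := by
  classical
  simp only [tilings, Finset.mem_filter, Finset.mem_powerset, and_iff_right_iff_imp]
  intro h t ht
  rw [Finset.mem_powerset, ← h.1.cover]
  exact Finset.subset_biUnion_of_mem id ht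

open Classical in
/-- The set `𝒟(lo / *)`: the union of `𝒟(lo / up)` over all Dyck paths `up` of the same length
as `lo`. -/
noncomputable def tilingsAbove (lo : DyckWord) : Finset (Finset (Finset Box)) :=
  (Finset.univ : Finset {up : DyckWord // up.semilength = lo.semilength}).biUnion fun up =>
    tilings lo up.1

/-- The number of boxes of the region tiled by `T`. -/
def area (T : Finset (Finset Box)) : ℕ := (T.biUnion id).card

/-- The statistic `art = (area + tiles) / 2`. For a Dyck tiling the sum is even, because each
Dyck tile consists of an odd number of boxes: see `two_mul_art`. -/
def art (T : Finset (Finset Box)) : ℕ := (area T + T.card) / 2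

theorem IsDyckTile.odd_card {t : Finset Box} (h : IsDyckTile t) : Odd t.card := by
  obtain ⟨w, a, b, rfl⟩ := h
  rw [Finset.card_image_of_injective, Finset.card_range]
  · exact ⟨_, rfl⟩
  · intro i j hij
    have := congrArg Prod.fst hij
    simpa using this

theorem two_mul_art {lo up : DyckWord} {T : Finset (Finset Box)} (h : IsDyckTiling lo up T) :
    2 * art T = area T + T.card := by
  have e : area T + T.card = ∑ t ∈ T, (t.card + 1) := by
    rw [Finset.sum_add_distrib, area, Finset.card_biUnion (fun s hs t ht hst => h.disjoint hs ht hst)]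
    simp
  have d : 2 ∣ area T + T.card := by
    rw [e]
    exact Finset.dvd_sum fun t ht => (h.tile t ht).odd_card.add_one.two_dvd
  rw [art, Nat.mul_div_cancel' d]

/-! ### Plane trees and labellings of Lascoux--Schützenberger type -/

/-- Plane trees whose edges carry elements of `α`. `empty` is the tree that consists of the root
only. `graft a below right` is the tree whose leftmost edge at the root carries `a` and has the
tree `below` hanging under it, joined at the root with the tree `right`. An edge is connected to
a leaf if and only if `below = empty`. -/
inductive PlaneTree (α : Type) : Type
  | empty : PlaneTree α
  | graft (a : α) (below right : PlaneTree α) : PlaneTree α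

/-- If the `U` at position `i` (counted from `0`) of `lam` is followed by a `D`, this is the
capacity of that partial word `UD` with respect to `lam0`: the number of `U`s among the first
`i + 1` letters of `lam0` minus the same number for `lam`. (The difference is nonnegative
whenever `lam0` is above `lam`.) -/
def capacity (lam lam0 : List DyckStep) (i : ℕ) : ℕ :=
  (lam0.take (i + 1)).count U - (lam.take (i + 1)).count U

/-- The plane tree of the Dyck word `w`: the tree of the empty word is empty, and the tree of
`U z D z'`, with `z` and `z'` Dyck words, is obtained by attaching an edge just above the tree of
`z` and joining the result with the tree of `z'` at the roots. If the first letter of `w` has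
position `pos` in a longer word, then the edge of the pair `U z D` carries `f i`, with `i` the
position of this `U` in the longer word. -/
def treeAux {α : Type} (f : ℕ → α) (pos : ℕ) (w : DyckWord) : PlaneTree α :=
  if w = 0 then .empty
  else .graft (f pos)
    (treeAux f (pos + 1) w.insidePart)
    (treeAux f (pos + 2 + 2 * w.insidePart.semilength) w.outsidePart)
termination_by w.semilength
decreasing_by
  · exact DyckWord.semilength_insidePart_lt ‹_›
  · exact DyckWord.semilength_outsidePart_lt ‹_›

/-- The tree `A(lam / lam0)`, i.e. the plane tree of `lam` with its capacities. Only the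
capacities on edges connected to leaves, which correspond to the partial words `UD`, are ever
used. -/
def capTree (lam : DyckWord) (lam0 : List DyckStep) : PlaneTree ℕ :=
  treeAux (capacity lam.toList lam0) 0 lam

/-- `IsLS A b ν`: the tree `ν` is a labelling of the edges of the tree with capacities `A` by
nonnegative integers such that the integers are non-increasing from the leaves to the root, the
integer on an edge connected to a leaf is at most its capacity, and the integers on the edges at
the root are at least `b`. -/
def IsLS : PlaneTree ℕ → ℕ → PlaneTree ℕ → Prop
  | .empty, _, .empty => True
  | .graft c l r, b, .graft v l' r' =>
      b ≤ v ∧ (l = .empty → v ≤ c) ∧ IsLS l v l' ∧ IsLS r b r'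
  | _, _, _ => False

/-- The sum of the integers on the edges. -/
def PlaneTree.sum : PlaneTree ℕ → ℕ
  | .empty => 0
  | .graft v l r => v + l.sum + r.sum

/-- The set of labellings of type LS of a tree with capacities. -/
def lsLabellings (A : PlaneTree ℕ) : Set (PlaneTree ℕ) := {ν | IsLS A 0 ν}

theorem IsLS.exists_bound (A : PlaneTree ℕ) (hA : A ≠ .empty) :
    ∃ N : ℕ, ∀ b ν, IsLS A b ν → b ≤ N := by
  induction A with
  | empty => exact absurd rfl hA
  | graft c l r ihl _ =>
    by_cases hl : l = .empty
    · refine ⟨c, fun b ν h => ?_⟩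
      cases ν with
      | empty => simp [IsLS] at h
      | graft v l' r' => exact h.1.trans (h.2.1 hl)
    · obtain ⟨N, hN⟩ := ihl hl
      refine ⟨N, fun b ν h => ?_⟩
      cases ν with
      | empty => simp [IsLS] at h
      | graft v l' r' => exact h.1.trans (hN v l' h.2.2.1)

theorem IsLS.finite (A : PlaneTree ℕ) : ∀ b, {ν | IsLS A b ν}.Finite := by
  induction A with
  | empty =>
    intro b
    refine (Set.finite_singleton PlaneTree.empty).subset fun ν h => ?_
    cases ν with
    | empty => rfl
    | graft v l' r' => simp [IsLS] at h
  | graft c l r ihl ihr =>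
    intro b
    obtain ⟨N, hN⟩ : ∃ N : ℕ, ∀ v l', (l = .empty → v ≤ c) → IsLS l v l' → v ≤ N := by
      by_cases hl : l = .empty
      · exact ⟨c, fun v _ h _ => h hl⟩
      · obtain ⟨N, hN⟩ := IsLS.exists_bound l hl
        exact ⟨N, fun v l' _ h => hN v l' h⟩
    have hf : (⋃ v ∈ Set.Iic N,
        Set.image2 (PlaneTree.graft v) {ν | IsLS l v ν} {ν | IsLS r b ν}).Finite :=
      (Set.finite_Iic N).biUnion fun v _ => (ihl v).image2 _ (ihr b)
    refine hf.subset fun ν h => ?_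
    cases ν with
    | empty => simp [IsLS] at h
    | graft v l' r' =>
      exact Set.mem_biUnion (hN v l' h.2.1 h.2.2.1) ⟨l', h.2.2.1, r', h.2.2.2, rfl⟩

theorem lsLabellings_finite (A : PlaneTree ℕ) : (lsLabellings A).Finite := IsLS.finite A 0

/-- The generating function `P_{lam, lam0}`, the sum of `q ^ (sum of ν)` over all labellings `ν`
of type LS of `A(lam / lam0)`. -/
noncomputable def lsPolynomial (lam : DyckWord) (lam0 : List DyckStep) : Polynomial ℤ :=
  ∑ ν ∈ (lsLabellings_finite (capTree lam lam0)).toFinset, Polynomial.X ^ ν.sum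

end DyckKL

/-! Both sides satisfy one recursion over the peaks `UD` of the lower path: for `lo ≠ 0`, F(lo) =
Σ_s q^(number of `D` before s) F(lo with the peak at s erased), and both are 1 at the empty path.

Labellings. With respect to U^(2n) the capacity of a leaf edge is the number of `D` before its `UD`.
Let every leaf label be less than K plus this number. A labelling allowed for K + 1 but not for K
has a leaf with the largest allowed label. Take the rightmost such leaf and delete it. The leaves to
its right now have one `D` less before them, so their bound for K + 1 in the smaller tree says
exactly that they were not maximal. This is `lsGenFun_succ`, proved algebraically along the first
return decomposition. At K = 0 a nonempty tree has no labelling, and the recursion remains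
(`lsGenFun_one_zero`).

Tilings. A tiling over the path with the peak at s erased grows to a tiling over `lo`: each box in
column s is replaced by a three-box peak, and single boxes are added along the down steps of the
upper path to the left of s. If k boxes lie in column s and the upper path has d down steps before
s, then `art` increases by k + d, which is the number of `D` before s in `lo` (`art_growth`).

Every tiling over `lo ≠ 0` is such a growth for exactly one s, namely its leftmost eligible peak.
The key is `singleton_mem_or_exists_isEligible`: under a down step of the upper path with no
eligible peak to its left there is a single-box tile. No box fits under the last step, so eligible
peaks exist; to the left of the leftmost one, the required strip of single boxes is present and can
be removed (`exists_growth_eq`). -/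

namespace DyckKL

open DyckStep

/-! ### Heights of lattice paths -/

/-- The ordinate of the endpoint of the lattice path with the steps `l`. -/
def listHeight (l : List DyckStep) : ℤ := (l.count U : ℤ) - (l.count D : ℤ)

theorem height_eq_listHeight (w : DyckWord) (i : ℕ) :
    height w i = listHeight (w.toList.take i) := rfl

@[simp] theorem listHeight_append (l₁ l₂ : List DyckStep) :
    listHeight (l₁ ++ l₂) = listHeight l₁ + listHeight l₂ := by
  simp [listHeight]; ring

@[simp] theorem listHeight_nil : listHeight [] = 0 := rfl

@[simp] theorem listHeight_cons_U (l : List DyckStep) :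
    listHeight (U :: l) = listHeight l + 1 := by
  simp [listHeight]; ring

@[simp] theorem listHeight_cons_D (l : List DyckStep) :
    listHeight (D :: l) = listHeight l - 1 := by
  simp [listHeight]; ring

theorem length_toList (w : DyckWord) : w.toList.length = 2 * w.semilength :=
  w.two_mul_semilength_eq_length.symm

theorem height_succ {w : DyckWord} {i : ℕ} (hi : i < w.toList.length) :
    height w (i + 1) = height w i + listHeight [w.toList[i]] := by
  rw [height_eq_listHeight, List.take_succ_eq_append_getElem hi, listHeight_append]
  rfl

theorem height_succ_of_U {w : DyckWord} {i : ℕ} (h : w.toList[i]? = some U) :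
    height w (i + 1) = height w i + 1 := by
  obtain ⟨hi, e⟩ := List.getElem?_eq_some_iff.1 h
  rw [height_succ hi, e]
  simp

theorem height_succ_of_D {w : DyckWord} {i : ℕ} (h : w.toList[i]? = some D) :
    height w (i + 1) = height w i - 1 := by
  obtain ⟨hi, e⟩ := List.getElem?_eq_some_iff.1 h
  rw [height_succ hi, e]
  simp
  ring

theorem getElem?_dichotomy {w : DyckWord} {i : ℕ} (hi : i < 2 * w.semilength) :
    w.toList[i]? = some U ∨ w.toList[i]? = some D := by
  rw [← length_toList] at hi
  rw [List.getElem?_eq_getElem hi, Option.some_inj, Option.some_inj]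
  exact DyckStep.dichotomy _

/-- `h` is the height function of a Dyck path of length `2 * n`, extended by zero. -/
structure IsDyckFun (n : ℕ) (h : ℕ → ℤ) : Prop where
  zero : h 0 = 0
  step : ∀ i < 2 * n, h (i + 1) = h i + 1 ∨ h (i + 1) = h i - 1
  nonneg : ∀ i, 0 ≤ h i
  tail : ∀ i, 2 * n ≤ i → h i = 0

theorem isDyckFun_height (w : DyckWord) : IsDyckFun w.semilength (height w) where
  zero := by simp [height]
  step i hi := (getElem?_dichotomy hi).imp height_succ_of_U height_succ_of_D
  nonneg i := by
    have := w.count_D_le_count_U i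
    simp only [height]
    omega
  tail i hi := by
    rw [height, List.take_of_length_le (by rwa [length_toList]), w.count_U_eq_count_D, sub_self]

theorem IsDyckFun.even {n : ℕ} {h : ℕ → ℤ} (H : IsDyckFun n h) {i : ℕ} (hi : i ≤ 2 * n) :
    Even (h i - i) := by
  induction i with
  | zero => simp [H.zero]
  | succ i ih =>
    have := ih (by omega)
    rcases H.step i (by omega) with e | e <;> rw [e] <;> push_cast <;> grind

theorem IsDyckFun.even_sub {n : ℕ} {h k : ℕ → ℤ} (H : IsDyckFun n h) (K : IsDyckFun n k)
    (i : ℕ) : Even (h i - k i) := by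
  rcases le_total i (2 * n) with hi | hi
  · have := (H.even hi).sub (K.even hi)
    grind
  · simp [H.tail i hi, K.tail i hi]

theorem listHeight_map_steps (h : ℕ → ℤ) (i : ℕ)
    (step : ∀ j < i, h (j + 1) = h j + 1 ∨ h (j + 1) = h j - 1) :
    listHeight ((List.range i).map fun j => if h j < h (j + 1) then U else D) = h i - h 0 := by
  induction i with
  | zero => simp
  | succ i ih =>
    rw [List.range_succ, List.map_append, listHeight_append, ih fun j hj => step j (by omega)]
    rcases step i (by omega) with e | e
    · simp [e]
      ring
    · rw [List.map_singleton, if_neg (by omega), e]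
      simp
      ring

/-- All new paths below, and the Dyck paths of tiles, are constructed as height functions; the word
is read off from the signs of the increments. -/
theorem IsDyckFun.exists_dyckWord {n : ℕ} {h : ℕ → ℤ} (H : IsDyckFun n h) :
    ∃ w : DyckWord, w.semilength = n ∧ height w = h := by
  set l := (List.range (2 * n)).map fun j => if h j < h (j + 1) then U else D with hl
  have take_eq : ∀ i, l.take i =
      (List.range (min i (2 * n))).map fun j => if h j < h (j + 1) then U else D := by
    intro i
    rw [hl, ← List.map_take, List.take_range]
  have key : ∀ i, listHeight (l.take i) = h i := by
    intro i
    rw [take_eq, listHeight_map_steps _ _ fun j hj => H.step j (by omega), H.zero, sub_zero]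
    rcases le_total i (2 * n) with hi | hi
    · rw [min_eq_left hi]
    · rw [min_eq_right hi, H.tail _ le_rfl, H.tail i hi]
  have len : l.length = 2 * n := by simp [hl]
  have tot : listHeight l = 0 := by
    have := key (2 * n)
    rwa [List.take_of_length_le len.le, H.tail _ le_rfl] at this
  refine ⟨⟨l, ?_, fun i => ?_⟩, ?_, ?_⟩
  · simp only [listHeight] at tot
    omega
  · have := key i
    have := H.nonneg i
    simp only [listHeight] at *
    omega
  · have := length_toList ⟨l, by simp only [listHeight] at tot; omega, fun i => by
      have := key i
      have := H.nonneg i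
      simp only [listHeight] at *
      omega⟩
    simp only [len] at this
    omega
  · funext i
    exact key i

theorem height_injective {v w : DyckWord} (hs : v.semilength = w.semilength)
    (h : height v = height w) : v = w := by
  apply DyckWord.ext
  apply List.ext_getElem?
  intro i
  rcases lt_or_ge i (2 * v.semilength) with hi | hi
  · have e : height v (i + 1) - height v i = height w (i + 1) - height w i := by rw [h]
    rcases getElem?_dichotomy hi with a | a <;>
      rcases getElem?_dichotomy (hs ▸ hi) with b | b <;> rw [a, b]
    · rw [height_succ_of_U a, height_succ_of_D b] at e
      omega
    · rw [height_succ_of_D a, height_succ_of_U b] at e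
      omega
  · rw [List.getElem?_eq_none (by rwa [length_toList]),
      List.getElem?_eq_none (by rwa [length_toList, ← hs])]

/-! ### Peaks -/

/-- The letters of `w` at positions `s` and `s + 1` are `UD`. -/
def IsPeak (w : DyckWord) (s : ℕ) : Prop :=
  w.toList[s]? = some U ∧ w.toList[s + 1]? = some D

instance (w : DyckWord) : DecidablePred (IsPeak w) := fun s =>
  inferInstanceAs (Decidable (w.toList[s]? = some U ∧ w.toList[s + 1]? = some D))

theorem IsPeak.lt {w : DyckWord} {s : ℕ} (h : IsPeak w s) : s + 1 < 2 * w.semilength := by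
  rw [← length_toList]
  exact (List.getElem?_eq_some_iff.1 h.2).1

theorem isPeak_iff_height {w : DyckWord} {s : ℕ} (hs : s + 1 < 2 * w.semilength) :
    IsPeak w s ↔ height w (s + 1) = height w s + 1 ∧ height w (s + 2) = height w s := by
  constructor
  · intro h
    have a := height_succ_of_U h.1
    have b := height_succ_of_D h.2
    exact ⟨a, by rw [b, a]; ring⟩
  · rintro ⟨a, b⟩
    constructor
    · rcases getElem?_dichotomy (show s < 2 * w.semilength by omega) with h | h
      · exact h
      · have := height_succ_of_D h
        omega
    · rcases getElem?_dichotomy hs with h | h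
      · have := height_succ_of_U h
        rw [show s + 1 + 1 = s + 2 from rfl] at this
        omega
      · exact h

theorem IsPeak.toList_eq {w : DyckWord} {s : ℕ} (h : IsPeak w s) :
    w.toList = w.toList.take s ++ U :: D :: w.toList.drop (s + 2) := by
  obtain ⟨h1, e1⟩ := List.getElem?_eq_some_iff.1 h.1
  obtain ⟨h2, e2⟩ := List.getElem?_eq_some_iff.1 h.2
  conv_lhs => rw [← List.take_append_drop s w.toList, List.drop_eq_getElem_cons h1, e1,
    List.drop_eq_getElem_cons h2, e2]

theorem IsPeak.listHeight_erase {w : DyckWord} {s : ℕ} (h : IsPeak w s) (i : ℕ) :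
    listHeight ((w.toList.take s ++ w.toList.drop (s + 2)).take i) =
      if i ≤ s then height w i else height w (i + 2) := by
  have hl : (w.toList.take s).length = s := by
    have := h.lt
    rw [List.length_take, length_toList]
    omega
  split_ifs with hi
  · rw [List.take_append_of_le_length (by omega), List.take_take, min_eq_left hi]
    rfl
  · obtain ⟨k, rfl⟩ : ∃ k, i = s + k := ⟨i - s, by omega⟩
    rw [height_eq_listHeight]
    conv_rhs => rw [h.toList_eq]
    generalize w.toList.take s = l at *
    rw [List.take_append, List.take_append, hl, show s + k + 2 - s = k + 2 by omega,
      show s + k - s = k by omega, List.take_of_length_le (l := l) (by omega),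
      List.take_of_length_le (l := l) (by omega)]
    simp

/-- The Dyck word `w` with the peak `UD` at positions `s` and `s + 1` removed. -/
def erasePeak (w : DyckWord) (s : ℕ) : DyckWord :=
  if h : IsPeak w s then
    { toList := w.toList.take s ++ w.toList.drop (s + 2)
      count_U_eq_count_D := by
        have := w.count_U_eq_count_D
        rw [h.toList_eq] at this
        simp at this
        simp
        omega
      count_D_le_count_U := fun i => by
        have h1 := h.listHeight_erase i
        have h2 : 0 ≤ if i ≤ s then height w i else height w (i + 2) := by
          split_ifs <;> exact (isDyckFun_height w).nonneg _
        rw [← h1, listHeight] at h2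
        omega }
  else w

theorem IsPeak.erasePeak_toList {w : DyckWord} {s : ℕ} (h : IsPeak w s) :
    (erasePeak w s).toList = w.toList.take s ++ w.toList.drop (s + 2) := by
  rw [erasePeak, dif_pos h]

theorem IsPeak.semilength_erasePeak {w : DyckWord} {s : ℕ} (h : IsPeak w s) :
    (erasePeak w s).semilength + 1 = w.semilength := by
  rw [DyckWord.semilength, DyckWord.semilength, h.erasePeak_toList]
  conv_rhs => rw [h.toList_eq]
  simp
  ring

theorem IsPeak.height_erasePeak {w : DyckWord} {s : ℕ} (h : IsPeak w s) (i : ℕ) :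
    height (erasePeak w s) i = if i ≤ s then height w i else height w (i + 2) := by
  rw [height_eq_listHeight, h.erasePeak_toList, h.listHeight_erase]

theorem two_mul_count_D_take {w : DyckWord} {i : ℕ} (hi : i ≤ 2 * w.semilength) :
    2 * ((w.toList.take i).count D : ℤ) = i - height w i := by
  induction i with
  | zero => simp [height]
  | succ i ih =>
    have := ih (by omega)
    have hi' : i < w.toList.length := by rw [length_toList]; omega
    rcases getElem?_dichotomy (show i < 2 * w.semilength by omega) with h | h
    · rw [height_succ_of_U h]
      obtain ⟨_, e⟩ := List.getElem?_eq_some_iff.1 h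
      rw [List.take_succ_eq_append_getElem hi', e]
      simp at *
      omega
    · rw [height_succ_of_D h]
      obtain ⟨_, e⟩ := List.getElem?_eq_some_iff.1 h
      rw [List.take_succ_eq_append_getElem hi', e]
      simp at *
      omega

/-! ### Peaks and the first return decomposition -/

theorem toList_nest_add (z v : DyckWord) :
    (z.nest + v).toList = U :: (z.toList ++ D :: v.toList) := by
  change ([U] ++ z.toList ++ [D]) ++ v.toList = _
  simp

theorem isPeak_nest_add_zero (z v : DyckWord) : IsPeak (z.nest + v) 0 ↔ z = 0 := by
  rw [IsPeak, toList_nest_add, ← DyckWord.toList_eq_nil]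
  rcases h : z.toList with _ | ⟨a, l⟩
  · simp
  · have hz : z.toList ≠ [] := by simp [h]
    have := z.head_eq_U hz
    simp only [h, List.head_cons] at this
    simp [this]

theorem isPeak_nest_add_inside {z : DyckWord} (v : DyckWord) {j : ℕ}
    (hj : j < 2 * z.semilength + 1) : IsPeak (z.nest + v) (j + 1) ↔ IsPeak z j := by
  have hl := length_toList z
  rcases lt_trichotomy (j + 1) (2 * z.semilength) with h | h | h
  · rw [IsPeak, toList_nest_add, List.getElem?_cons_succ, List.getElem?_cons_succ,
      List.getElem?_append_left (by omega), List.getElem?_append_left (by omega), IsPeak]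
  -- The last letter of `z` is `D`, so no peak straddles the end of `z`.
  · have not_U : z.toList[j]? ≠ some U := by
      intro e
      have h1 := height_succ_of_U e
      have h2 := (isDyckFun_height z).nonneg j
      rw [(isDyckFun_height z).tail (j + 1) h.ge] at h1
      omega
    rw [IsPeak, toList_nest_add, List.getElem?_cons_succ,
      List.getElem?_append_left (by omega), IsPeak]
    simp [not_U]
  · rw [IsPeak, toList_nest_add, List.getElem?_cons_succ, IsPeak, show j = z.toList.length by omega]
    simp

theorem isPeak_nest_add_outside (z v : DyckWord) (j : ℕ) :
    IsPeak (z.nest + v) (2 * z.semilength + 2 + j) ↔ IsPeak v j := by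
  have hl := length_toList z
  rw [IsPeak, toList_nest_add, show 2 * z.semilength + 2 + j = z.toList.length + (j + 1) + 1 by omega,
    List.getElem?_cons_succ, List.getElem?_cons_succ, List.getElem?_append_right (by omega),
    List.getElem?_append_right (by omega),
    show z.toList.length + (j + 1) - z.toList.length = j + 1 by omega,
    show z.toList.length + (j + 1) + 1 - z.toList.length = j + 1 + 1 by omega,
    List.getElem?_cons_succ, List.getElem?_cons_succ, IsPeak]

/-- The positions of the peaks of a Dyck word. -/
def peaks (w : DyckWord) : Finset ℕ := (Finset.range (2 * w.semilength)).filter (IsPeak w)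

@[simp] theorem mem_peaks {w : DyckWord} {s : ℕ} : s ∈ peaks w ↔ IsPeak w s := by
  simp only [peaks, Finset.mem_filter, Finset.mem_range, and_iff_right_iff_imp]
  intro h
  have := h.lt
  omega

theorem sum_peaks_nest_add {M : Type*} [AddCommMonoid M] (z v : DyckWord) (g : ℕ → M) :
    ∑ s ∈ peaks (z.nest + v), g s = ((if z = 0 then g 0 else 0) + ∑ s ∈ peaks z, g (s + 1)) +
      ∑ s ∈ peaks v, g (2 * z.semilength + 2 + s) := by
  simp only [peaks, Finset.sum_filter]
  rw [DyckWord.semilength_add, DyckWord.semilength_nest,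
    show 2 * (z.semilength + 1 + v.semilength) = (2 * z.semilength + 1 + 1) + 2 * v.semilength by ring,
    Finset.sum_range_add, Finset.sum_range_succ']
  congr 1
  · rw [add_comm]
    congr 1
    · simp only [isPeak_nest_add_zero]
    · rw [Finset.sum_congr rfl (g := fun s => if IsPeak z s then g (s + 1) else 0) fun s hs =>
        if_congr (isPeak_nest_add_inside v (Finset.mem_range.1 hs)) rfl rfl]
      rw [Finset.sum_range_succ, if_neg, add_zero]
      intro h
      have := h.lt
      omega
  · exact Finset.sum_congr rfl fun s _ => if_congr (isPeak_nest_add_outside z v s) rfl rfl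

theorem erasePeak_nest_add_zero (v : DyckWord) :
    erasePeak ((0 : DyckWord).nest + v) 0 = v := by
  apply DyckWord.ext
  rw [IsPeak.erasePeak_toList ((isPeak_nest_add_zero 0 v).2 rfl), toList_nest_add]
  rfl

theorem IsPeak.erasePeak_nest_add_inside {z : DyckWord} {s : ℕ} (h : IsPeak z s) (v : DyckWord) :
    erasePeak (z.nest + v) (s + 1) = (erasePeak z s).nest + v := by
  have hs := h.lt
  have hl := length_toList z
  apply DyckWord.ext
  rw [IsPeak.erasePeak_toList ((isPeak_nest_add_inside v (by omega)).2 h), toList_nest_add,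
    toList_nest_add, h.erasePeak_toList, List.take_succ_cons,
    show s + 1 + 2 = (s + 2) + 1 from rfl, List.drop_succ_cons,
    List.take_append_of_le_length (by omega), List.drop_append_of_le_length (by omega)]
  simp

theorem IsPeak.erasePeak_nest_add_outside {v : DyckWord} {s : ℕ} (h : IsPeak v s) (z : DyckWord) :
    erasePeak (z.nest + v) (2 * z.semilength + 2 + s) = z.nest + erasePeak v s := by
  have hl := length_toList z
  apply DyckWord.ext
  rw [IsPeak.erasePeak_toList ((isPeak_nest_add_outside z v s).2 h), toList_nest_add,
    toList_nest_add, h.erasePeak_toList,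
    show 2 * z.semilength + 2 + s + 2 = z.toList.length + (s + 2 + 1) + 1 by omega,
    show 2 * z.semilength + 2 + s = z.toList.length + (s + 1) + 1 by omega, List.take_succ_cons,
    List.drop_succ_cons, List.take_length_add_append, List.drop_length_add_append]
  simp

theorem count_D_take_nest_add_inside {z : DyckWord} (v : DyckWord) {s : ℕ}
    (hs : s ≤ 2 * z.semilength) :
    ((z.nest + v).toList.take (s + 1)).count D = (z.toList.take s).count D := by
  rw [toList_nest_add, List.take_succ_cons,
    List.take_append_of_le_length (by rwa [length_toList])]
  simp

theorem count_D_take_nest_add_outside (z v : DyckWord) (s : ℕ) :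
    ((z.nest + v).toList.take (2 * z.semilength + 2 + s)).count D =
      z.semilength + 1 + (v.toList.take s).count D := by
  have hl := length_toList z
  rw [toList_nest_add,
    show 2 * z.semilength + 2 + s = z.toList.length + (s + 1) + 1 by omega, List.take_succ_cons,
    List.take_length_add_append, DyckWord.semilength_eq_count_D]
  simp
  ring

/-- Induction along the first return decomposition, the recursion that defines both `treeAux` and
`lsGenFun`. -/
theorem DyckWord.nest_add_induction {P : DyckWord → Prop} (zero : P 0)
    (nest_add : ∀ z v, P z → P v → P (z.nest + v)) (w : DyckWord) : P w := by
  induction hn : w.semilength using Nat.strong_induction_on generalizing w with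
  | _ n ih =>
    by_cases h : w = 0
    · exact h ▸ zero
    · rw [← DyckWord.nest_insidePart_add_outsidePart h]
      exact nest_add _ _ (ih _ (hn ▸ DyckWord.semilength_insidePart_lt h) _ rfl)
        (ih _ (hn ▸ DyckWord.semilength_outsidePart_lt h) _ rfl)

/-! ### Labellings of type LS -/

open Polynomial

/-- The generating function of the labellings of type LS of the tree of `w` with all integers on
the edges at the root at least `b`, where the integer on a leaf edge is less than `K` plus the
number of letters `D` before the corresponding `UD`. -/
noncomputable def lsGenFun (w : DyckWord) (K b : ℕ) : ℤ[X] :=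
  if w = 0 then 1
  else (∑ v ∈ Finset.Ico b K, X ^ v * lsGenFun w.insidePart K v) *
    lsGenFun w.outsidePart (K + 1 + w.insidePart.semilength) b
termination_by w.semilength
decreasing_by
  · exact DyckWord.semilength_insidePart_lt ‹_›
  · exact DyckWord.semilength_outsidePart_lt ‹_›

@[simp] theorem lsGenFun_zero (K b : ℕ) : lsGenFun 0 K b = 1 := by
  rw [lsGenFun, if_pos rfl]

theorem nest_add_ne_zero (z v : DyckWord) : z.nest + v ≠ 0 := by
  intro h
  have := congrArg DyckWord.semilength h
  simp at this

theorem lsGenFun_nest_add (z v : DyckWord) (K b : ℕ) :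
    lsGenFun (z.nest + v) K b = (∑ u ∈ Finset.Ico b K, X ^ u * lsGenFun z K u) *
      lsGenFun v (K + 1 + z.semilength) b := by
  rw [lsGenFun, if_neg (nest_add_ne_zero z v)]
  simp

/-- The leftmost edge at the root would need a label in an empty interval. -/
theorem lsGenFun_of_le {w : DyckWord} (hw : w ≠ 0) {K b : ℕ} (h : K ≤ b) :
    lsGenFun w K b = 0 := by
  rw [← DyckWord.nest_insidePart_add_outsidePart hw, lsGenFun_nest_add, Finset.Ico_eq_empty_of_le h]
  simp

/-- The summand of `s` counts the labellings in which `s` is the rightmost leaf with the largest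
allowed label, `K` plus the number of `D` before it. The condition `b ≤ K` makes this label
admissible at the root. -/
theorem lsGenFun_succ (w : DyckWord) : ∀ K b, b ≤ K → lsGenFun w (K + 1) b = lsGenFun w K b +
    ∑ s ∈ peaks w, X ^ (K + (w.toList.take s).count D) * lsGenFun (erasePeak w s) (K + 1) b := by
  induction w using DyckWord.nest_add_induction with
  | zero =>
    intro K b _
    simp [peaks]
  | nest_add z v ihz ihv =>
    intro K b hb
    have planted : ∑ u ∈ Finset.Ico b (K + 1), X ^ u * lsGenFun z (K + 1) u =
        ∑ u ∈ Finset.Ico b K, X ^ u * lsGenFun z K u + ((if z = 0 then X ^ K else 0) +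
          ∑ s ∈ peaks z, X ^ (K + (z.toList.take s).count D) *
            ∑ u ∈ Finset.Ico b (K + 1), X ^ u * lsGenFun (erasePeak z s) (K + 1) u) := by
      -- The new root label `u = K` leaves no room for labels below `K` in a nonempty `z`; it
      -- contributes only if the edge is itself a leaf.
      have e : ∑ u ∈ Finset.Ico b (K + 1), X ^ u * lsGenFun z K u =
          ∑ u ∈ Finset.Ico b K, X ^ u * lsGenFun z K u + if z = 0 then X ^ K else 0 := by
        rw [Finset.sum_Ico_succ_top hb]
        split_ifs with hz
        · simp [hz]
        · rw [lsGenFun_of_le hz le_rfl, mul_zero]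
      rw [← add_assoc, ← e]
      simp_rw [Finset.mul_sum]
      rw [Finset.sum_comm, ← Finset.sum_add_distrib]
      refine Finset.sum_congr rfl fun u hu => ?_
      rw [ihz K u (by have := (Finset.mem_Ico.1 hu).2; omega), mul_add, Finset.mul_sum]
      congr 1
      exact Finset.sum_congr rfl fun s _ => by ring
    rw [sum_peaks_nest_add, lsGenFun_nest_add, lsGenFun_nest_add,
      show K + 1 + 1 + z.semilength = (K + 1 + z.semilength) + 1 by ring,
      ihv (K + 1 + z.semilength) b (by omega)]
    have first : (if z = 0 then X ^ (K + ((z.nest + v).toList.take 0).count D) *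
        lsGenFun (erasePeak (z.nest + v) 0) (K + 1) b else 0) =
        (if z = 0 then X ^ K else 0) * lsGenFun v (K + 1 + z.semilength) b := by
      split_ifs with hz
      · subst hz
        rw [erasePeak_nest_add_zero]
        simp
      · simp
    have inside : ∑ s ∈ peaks z, X ^ (K + ((z.nest + v).toList.take (s + 1)).count D) *
        lsGenFun (erasePeak (z.nest + v) (s + 1)) (K + 1) b =
        (∑ s ∈ peaks z, X ^ (K + (z.toList.take s).count D) *
            ∑ u ∈ Finset.Ico b (K + 1), X ^ u * lsGenFun (erasePeak z s) (K + 1) u) *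
          lsGenFun v (K + 1 + z.semilength) b := by
      rw [Finset.sum_mul]
      refine Finset.sum_congr rfl fun s hs => ?_
      rw [mem_peaks] at hs
      -- Erasing a peak inside `z` removes a `D` before `v`, so `v` keeps its old bound although `K`
      -- has increased.
      rw [count_D_take_nest_add_inside v (by have := hs.lt; omega), hs.erasePeak_nest_add_inside,
        lsGenFun_nest_add, ← hs.semilength_erasePeak,
        show K + 1 + ((erasePeak z s).semilength + 1) = K + 1 + 1 + (erasePeak z s).semilength by ring]
      ring
    have outside : ∑ s ∈ peaks v,
        X ^ (K + ((z.nest + v).toList.take (2 * z.semilength + 2 + s)).count D) *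
        lsGenFun (erasePeak (z.nest + v) (2 * z.semilength + 2 + s)) (K + 1) b =
        (∑ u ∈ Finset.Ico b (K + 1), X ^ u * lsGenFun z (K + 1) u) *
          ∑ s ∈ peaks v, X ^ (K + 1 + z.semilength + (v.toList.take s).count D) *
            lsGenFun (erasePeak v s) (K + 1 + z.semilength + 1) b := by
      rw [Finset.mul_sum]
      refine Finset.sum_congr rfl fun s hs => ?_
      rw [mem_peaks] at hs
      rw [count_D_take_nest_add_outside, hs.erasePeak_nest_add_outside, lsGenFun_nest_add,
        show K + 1 + 1 + z.semilength = K + 1 + z.semilength + 1 by ring]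
      ring
    -- With A, B the old and A', B' the new factors of `z` and `v`: A'B' = AB + (A' - A)B + A'(B' -
    -- B). The peaks up to the end of `z` give the middle term, those of `v` the last.
    rw [first, inside, outside, planted]
    ring

/-! ### From trees with capacities to `lsGenFun` -/

theorem treeAux_nest_add {α : Type} (f : ℕ → α) (pos : ℕ) (z v : DyckWord) :
    treeAux f pos (z.nest + v) =
      .graft (f pos) (treeAux f (pos + 1) z) (treeAux f (pos + 2 + 2 * z.semilength) v) := by
  rw [treeAux, if_neg (nest_add_ne_zero z v)]
  congr <;> simp

@[simp] theorem treeAux_zero {α : Type} (f : ℕ → α) (pos : ℕ) : treeAux f pos 0 = .empty := by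
  rw [treeAux, if_pos rfl]

theorem treeAux_eq_empty {α : Type} (f : ℕ → α) (pos : ℕ) (w : DyckWord) :
    treeAux f pos w = .empty ↔ w = 0 := by
  constructor
  · intro h
    by_contra hw
    rw [← DyckWord.nest_insidePart_add_outsidePart hw, treeAux_nest_add] at h
    cases h
  · rintro rfl
    simp

/-- The leftmost leaf has no `D` before it, hence capacity `κ`, and labels do not increase towards
the root. This is why `lsGenFun` may bound the labels of inner edges by `K` as well. -/
theorem isLS_treeAux_lt {f : ℕ → ℕ} {κ : ℕ} (w : DyckWord) : ∀ (pos b : ℕ) (ν : PlaneTree ℕ),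
    (∀ j < 2 * w.semilength, f (pos + j) = κ + (w.toList.take (j + 1)).count D) →
    IsLS (treeAux f pos w) b ν → w = 0 ∨ b ≤ κ := by
  induction w using DyckWord.nest_add_induction with
  | zero => simp
  | nest_add z v ihz ihv =>
    intro pos b ν hf h
    right
    rw [treeAux_nest_add] at h
    cases ν with
    | empty => simp [IsLS] at h
    | graft u l r =>
      obtain ⟨h1, h2, h3, -⟩ := h
      by_cases hz : z = 0
      · have h0 := hf 0 (by simp)
        subst hz
        rw [toList_nest_add] at h0
        simp at h0
        simp [h0] at h2
        omega
      · refine h1.trans ((ihz (pos + 1) u l (fun j hj => ?_) h3).resolve_left hz)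
        rw [show pos + 1 + j = pos + (j + 1) by ring, hf (j + 1) (by rw [DyckWord.semilength_add, DyckWord.semilength_nest]; omega),
          count_D_take_nest_add_inside v (by omega)]

/-- The hypotheses on `K` say that `v < K` holds for every admissible label of the first edge and,
on a leaf, enforces the capacity `c`. -/
theorem sum_isLS_graft (c : ℕ) (l r : PlaneTree ℕ) (b K : ℕ)
    (hK : ∀ v ν, (l = .empty → v ≤ c) → IsLS l v ν → v < K)
    (hc : l = .empty → K ≤ c + 1) :
    ∑ ν ∈ (IsLS.finite (.graft c l r) b).toFinset, (X : ℤ[X]) ^ ν.sum =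
      (∑ v ∈ Finset.Ico b K, X ^ v * ∑ ν ∈ (IsLS.finite l v).toFinset, X ^ ν.sum) *
        ∑ ν ∈ (IsLS.finite r b).toFinset, X ^ ν.sum := by
  rw [Finset.sum_congr rfl fun v _ => Finset.mul_sum _ _ _, Finset.sum_sigma', Finset.sum_mul_sum,
    ← Finset.sum_product']
  refine Finset.sum_bij'
    (fun ν _ => match ν with
      | .empty => (⟨0, .empty⟩, .empty)
      | .graft v l' r' => (⟨v, l'⟩, r'))
    (fun p _ => .graft p.1.1 p.1.2 p.2) ?_ ?_ ?_ ?_ ?_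
  · intro ν hν
    rw [Set.Finite.mem_toFinset, Set.mem_ofPred_eq] at hν
    cases ν with
    | empty => simp [IsLS] at hν
    | graft v l' r' =>
      obtain ⟨h1, h2, h3, h4⟩ := hν
      simp only [Finset.mem_product, Finset.mem_sigma, Finset.mem_Ico, Set.Finite.mem_toFinset,
        Set.mem_ofPred_eq]
      exact ⟨⟨⟨h1, hK v l' h2 h3⟩, h3⟩, h4⟩
  · rintro ⟨⟨v, l'⟩, r'⟩ hp
    simp only [Finset.mem_product, Finset.mem_sigma, Finset.mem_Ico, Set.Finite.mem_toFinset,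
      Set.mem_ofPred_eq] at hp ⊢
    refine ⟨hp.1.1.1, fun hl => ?_, hp.1.2, hp.2⟩
    have := hc hl
    omega
  · intro ν hν
    rw [Set.Finite.mem_toFinset, Set.mem_ofPred_eq] at hν
    cases ν with
    | empty => simp [IsLS] at hν
    | graft v l' r' => rfl
  · intro p _
    rfl
  · intro ν hν
    rw [Set.Finite.mem_toFinset, Set.mem_ofPred_eq] at hν
    cases ν with
    | empty => simp [IsLS] at hν
    | graft v l' r' =>
      simp only [PlaneTree.sum]
      ring

/-- Capacities are weak bounds and `K` is a strict one, whence `κ + 1`. -/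
theorem sum_isLS_treeAux {f : ℕ → ℕ} (w : DyckWord) : ∀ (κ pos b : ℕ),
    (∀ j < 2 * w.semilength, f (pos + j) = κ + (w.toList.take (j + 1)).count D) →
    ∑ ν ∈ (IsLS.finite (treeAux f pos w) b).toFinset, (X : ℤ[X]) ^ ν.sum =
      lsGenFun w (κ + 1) b := by
  induction w using DyckWord.nest_add_induction with
  | zero =>
    intro κ pos b _
    have e : (IsLS.finite (treeAux f pos 0) b).toFinset = {.empty} := by
      ext ν
      rw [Set.Finite.mem_toFinset, Set.mem_ofPred_eq, treeAux_zero, Finset.mem_singleton]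
      cases ν <;> simp [IsLS]
    rw [e, lsGenFun_zero, Finset.sum_singleton]
    simp [PlaneTree.sum]
  | nest_add z v ihz ihv =>
    intro κ pos b hf
    have hfz : ∀ j < 2 * z.semilength, f (pos + 1 + j) = κ + (z.toList.take (j + 1)).count D := by
      intro j hj
      rw [show pos + 1 + j = pos + (j + 1) by ring,
        hf (j + 1) (by rw [DyckWord.semilength_add, DyckWord.semilength_nest]; omega),
        count_D_take_nest_add_inside v (by omega)]
    have hfv : ∀ j < 2 * v.semilength, f (pos + 2 + 2 * z.semilength + j) =
        κ + 1 + z.semilength + (v.toList.take (j + 1)).count D := by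
      intro j hj
      rw [show pos + 2 + 2 * z.semilength + j = pos + (2 * z.semilength + 2 + j) by ring,
        hf _ (by rw [DyckWord.semilength_add, DyckWord.semilength_nest]; omega),
        show 2 * z.semilength + 2 + j + 1 = 2 * z.semilength + 2 + (j + 1) by ring,
        count_D_take_nest_add_outside]
      ring
    have hf0 : z = 0 → f pos = κ := by
      rintro rfl
      have := hf 0 (by simp)
      rw [toList_nest_add] at this
      simpa using this
    have hs := sum_isLS_graft (f pos) (treeAux f (pos + 1) z)
      (treeAux f (pos + 2 + 2 * z.semilength) v) b (κ + 1) (fun u ν h1 h2 => by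
        rw [treeAux_eq_empty] at h1
        rcases isLS_treeAux_lt z (pos + 1) u ν hfz h2 with h | h
        · have := h1 h
          have := hf0 h
          omega
        · omega) (fun h => by
        rw [treeAux_eq_empty] at h
        rw [hf0 h])
    have e := treeAux_nest_add f pos z v
    rw [lsGenFun_nest_add]
    simp only [e]
    rw [hs, ihv (κ + 1 + z.semilength) _ _ hfv,
      show κ + 1 + 1 + z.semilength = κ + 1 + z.semilength + 1 by ring]
    congr 1
    refine Finset.sum_congr rfl fun u _ => ?_
    rw [ihz κ _ _ hfz]

theorem count_U_add_count_D (l : List DyckStep) : l.count U + l.count D = l.length := by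
  induction l with
  | nil => rfl
  | cons a l ih => cases a <;> simp <;> omega

/-- Against a word of `U`s only, the capacity at position `j` is `j + 1` minus the number of `U`,
that is, the number of `D` among the first `j + 1` letters; so `κ = 0`. -/
theorem lsPolynomial_replicate (w : DyckWord) :
    lsPolynomial w (List.replicate (2 * w.semilength) U) = lsGenFun w 1 0 := by
  have := sum_isLS_treeAux (f := capacity w.toList (List.replicate (2 * w.semilength) U)) w 0 0 0
    (fun j hj => by
      have hl := length_toList w
      have := count_U_add_count_D (w.toList.take (j + 1))
      rw [List.length_take] at this
      rw [capacity, List.take_replicate, List.count_replicate_self]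
      simp only [zero_add]
      omega)
  rw [← this]
  rfl

theorem lsGenFun_one_zero {w : DyckWord} (hw : w ≠ 0) : lsGenFun w 1 0 =
    ∑ s ∈ peaks w, X ^ ((w.toList.take s).count D) * lsGenFun (erasePeak w s) 1 0 := by
  have := lsGenFun_succ w 0 0 le_rfl
  rw [lsGenFun_of_le hw le_rfl] at this
  simpa using this

/-! ### Membership descriptions of skew shapes, tiles and tilings -/

theorem LiesBelow.even_sub {lo up : DyckWord} (h : LiesBelow lo up) (x : ℕ) :
    Even (height up x - height lo x) :=
  IsDyckFun.even_sub (isDyckFun_height up) (h.1 ▸ isDyckFun_height lo) x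

theorem mem_skewShape {lo up : DyckWord} (h : LiesBelow lo up) {x : ℕ} {y : ℤ} :
    (x, y) ∈ skewShape lo up ↔ height lo x < y ∧ y < height up x ∧ Odd (y - height lo x) := by
  simp only [skewShape, Finset.mem_biUnion, Finset.mem_range, Finset.mem_image, Finset.mem_filter,
    Finset.mem_Ioo, Prod.mk.injEq]
  constructor
  · rintro ⟨x', _, y', ⟨⟨h1, h2⟩, h3⟩, rfl, rfl⟩
    exact ⟨h1, h2, h3⟩
  · rintro ⟨h1, h2, h3⟩
    refine ⟨x, ?_, y, ⟨⟨h1, h2⟩, h3⟩, rfl, rfl⟩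
    by_contra hx
    have := (isDyckFun_height lo).tail x (by omega)
    have := (isDyckFun_height up).tail x (by have := h.1; omega)
    omega

theorem skewShape_injective {lo up₁ up₂ : DyckWord} (h₁ : LiesBelow lo up₁)
    (h₂ : LiesBelow lo up₂) (h : skewShape lo up₁ = skewShape lo up₂) : up₁ = up₂ := by
  have aux : ∀ {u v : DyckWord}, LiesBelow lo u → LiesBelow lo v →
      skewShape lo u = skewShape lo v → ∀ x, height u x ≤ height v x := by
    intro u v hu hv e x
    by_contra! hlt
    have p1 := hu.even_sub x
    have p2 := hv.even_sub x
    have l := hv.2 x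
    -- The top box of column `x` under `u` would stick out above `v`.
    have : (x, height u x - 1) ∈ skewShape lo v := by
      rw [← e, mem_skewShape hu]
      rw [Int.even_iff] at p1 p2
      rw [Int.odd_iff]
      omega
    rw [mem_skewShape hv, Int.odd_iff] at this
    rw [Int.even_iff] at p1 p2
    omega
  refine height_injective (h₁.1.symm.trans h₂.1) (funext fun x => le_antisymm ?_ ?_)
  · exact aux h₁ h₂ h x
  · exact aux h₂ h₁ h.symm x

/-- The boxes of `t` are the points of the graph of `f` with abscissae from `a` to `e`, and `f` is
on that interval a Dyck path up to translation. -/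
structure IsTileGraph (t : Finset Box) (a e : ℕ) (f : ℕ → ℤ) : Prop where
  le : a ≤ e
  ends : f e = f a
  step : ∀ x, a ≤ x → x < e → f (x + 1) = f x + 1 ∨ f (x + 1) = f x - 1
  base : ∀ x, a ≤ x → x ≤ e → f a ≤ f x
  mem : ∀ x y, (x, y) ∈ t ↔ a ≤ x ∧ x ≤ e ∧ y = f x

theorem isDyckTile_iff {t : Finset Box} : IsDyckTile t ↔ ∃ a e f, IsTileGraph t a e f := by
  constructor
  · rintro ⟨w, a, b, rfl⟩
    have H := isDyckFun_height w
    refine ⟨a, a + 2 * w.semilength, fun x => b + height w (x - a), by omega, ?_, ?_, ?_, ?_⟩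
    · simp only [Nat.sub_self, Nat.add_sub_cancel_left, H.zero, H.tail _ le_rfl]
    · intro x h1 h2
      obtain ⟨i, rfl⟩ := Nat.exists_eq_add_of_le h1
      have := H.step i (by omega)
      simp only [show a + i + 1 - a = i + 1 by omega, show a + i - a = i by omega]
      omega
    · intro x _ _
      have := H.nonneg (x - a)
      simp only [Nat.sub_self, H.zero]
      omega
    · intro x y
      simp only [Finset.mem_image, Finset.mem_range, Prod.mk.injEq]
      constructor
      · rintro ⟨i, hi, rfl, rfl⟩
        refine ⟨by omega, by omega, by simp⟩
      · rintro ⟨h1, h2, rfl⟩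
        exact ⟨x - a, by omega, by omega, rfl⟩
  · rintro ⟨a, e, f, H⟩
    -- Steps change the parity and both ends have equal height, so `e - a` is even.
    have par : ∀ i, a + i ≤ e → Even (f (a + i) - f a - i) := by
      intro i
      induction i with
      | zero => simp
      | succ i ih =>
        intro hi
        have h1 := ih (by omega)
        rw [Int.even_iff] at h1 ⊢
        have := H.step (a + i) (by omega) (by omega)
        rw [add_assoc] at this
        push_cast
        omega
    obtain ⟨n, hn⟩ : ∃ n, e = a + 2 * n := by
      have h1 := H.le
      have h2 := par (e - a) (by omega)
      rw [show a + (e - a) = e by omega, H.ends, Int.even_iff] at h2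
      exact ⟨(e - a) / 2, by omega⟩
    have K : IsDyckFun n fun i => if i ≤ 2 * n then f (a + i) - f a else 0 := by
      refine ⟨by simp, ?_, ?_, ?_⟩
      · intro i hi
        simp only [if_pos hi.le, if_pos (show i + 1 ≤ 2 * n by omega)]
        have := H.step (a + i) (by omega) (by omega)
        rw [add_assoc] at this
        omega
      · intro i
        split_ifs with hi
        · have := H.base (a + i) (by omega) (by omega)
          omega
        · exact le_rfl
      · intro i hi
        split_ifs with hi'
        · rw [show i = 2 * n by omega, ← hn, H.ends, sub_self]
        · rfl
    obtain ⟨w, hw, hh⟩ := K.exists_dyckWord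
    refine ⟨w, a, f a, ?_⟩
    ext ⟨x, y⟩
    rw [H.mem]
    simp only [Finset.mem_image, Finset.mem_range, Prod.mk.injEq, hw, hh]
    constructor
    · rintro ⟨h1, h2, rfl⟩
      refine ⟨x - a, by omega, by omega, ?_⟩
      rw [if_pos (by omega), show a + (x - a) = x by omega]
      ring
    · rintro ⟨i, hi, rfl, rfl⟩
      refine ⟨by omega, by omega, ?_⟩
      rw [if_pos (by omega)]
      ring

theorem isDyckTile_singleton (p : Box) : IsDyckTile {p} := by
  refine isDyckTile_iff.2 ⟨p.1, p.1, fun _ => p.2, le_rfl, rfl, ?_, ?_, ?_⟩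
  · intros
    omega
  · intros
    rfl
  · intro x y
    rw [Finset.mem_singleton, Prod.ext_iff]
    grind

theorem IsDyckTile.nonempty {t : Finset Box} (h : IsDyckTile t) : t.Nonempty :=
  Finset.card_pos.1 h.odd_card.pos

theorem isDyckTiling_iff {lo up : DyckWord} {T : Finset (Finset Box)} :
    IsDyckTiling lo up T ↔ LiesBelow lo up ∧ (∀ t ∈ T, IsDyckTile t) ∧
      (∀ t₁ ∈ T, ∀ t₂ ∈ T, ∀ p, p ∈ t₁ → p ∈ t₂ → t₁ = t₂) ∧
      ∀ p, (∃ t ∈ T, p ∈ t) ↔ p ∈ skewShape lo up := by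
  constructor
  · rintro ⟨h1, h2, h3, h4⟩
    refine ⟨h1, h2, fun t₁ m₁ t₂ m₂ p p₁ p₂ => ?_, fun p => ?_⟩
    · by_contra hne
      exact Finset.disjoint_left.1 (h3 m₁ m₂ hne) p₁ p₂
    · rw [← h4]
      simp
  · rintro ⟨h1, h2, h3, h4⟩
    refine ⟨h1, h2, fun t₁ m₁ t₂ m₂ hne => ?_, ?_⟩
    · exact Finset.disjoint_left.2 fun p p₁ p₂ => hne (h3 t₁ m₁ t₂ m₂ p p₁ p₂)
    · ext p
      rw [← h4]
      simp

theorem IsDyckTiling.eq_of_mem {lo up : DyckWord} {T : Finset (Finset Box)}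
    (h : IsDyckTiling lo up T) {t₁ t₂ : Finset Box} (h₁ : t₁ ∈ T) (h₂ : t₂ ∈ T) {p : Box}
    (p₁ : p ∈ t₁) (p₂ : p ∈ t₂) : t₁ = t₂ :=
  (isDyckTiling_iff.1 h).2.2.1 t₁ h₁ t₂ h₂ p p₁ p₂

theorem IsDyckTiling.exists_mem_iff {lo up : DyckWord} {T : Finset (Finset Box)}
    (h : IsDyckTiling lo up T) {p : Box} : (∃ t ∈ T, p ∈ t) ↔ p ∈ skewShape lo up :=
  (isDyckTiling_iff.1 h).2.2.2 p

theorem IsDyckTiling.mem_skewShape {lo up : DyckWord} {T : Finset (Finset Box)}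
    (h : IsDyckTiling lo up T) {t : Finset Box} (ht : t ∈ T) {p : Box} (hp : p ∈ t) :
    p ∈ skewShape lo up :=
  h.exists_mem_iff.1 ⟨t, ht, hp⟩

theorem isCoverInclusive_iff {lo : DyckWord} {T : Finset (Finset Box)} :
    IsCoverInclusive lo T ↔ ∀ t ∈ T, (∀ p ∈ t, p.2 - 2 < height lo p.1) ∨
      ∃ s ∈ T, s ≠ t ∧ ∀ p ∈ t, (p.1, p.2 - 2) ∈ s := by
  simp only [IsCoverInclusive, shiftDown, Finset.forall_mem_image, Finset.image_subset_iff]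

theorem mem_tilingsAbove {lo : DyckWord} {T : Finset (Finset Box)} :
    T ∈ tilingsAbove lo ↔ ∃ up, IsDyckTiling lo up T ∧ IsCoverInclusive lo T := by
  simp only [tilingsAbove, Finset.mem_biUnion, Finset.mem_univ, true_and, mem_tilings]
  constructor
  · rintro ⟨up, h⟩
    exact ⟨up, h⟩
  · rintro ⟨up, h⟩
    exact ⟨⟨up, h.1.below.1.symm⟩, h⟩

theorem IsDyckTiling.up_unique {lo up₁ up₂ : DyckWord} {T : Finset (Finset Box)}
    (h₁ : IsDyckTiling lo up₁ T) (h₂ : IsDyckTiling lo up₂ T) : up₁ = up₂ :=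
  skewShape_injective h₁.below h₂.below (h₁.cover.symm.trans h₂.cover)

theorem IsDyckTiling.two_mul_art_eq_sum {lo up : DyckWord} {T : Finset (Finset Box)}
    (h : IsDyckTiling lo up T) : 2 * art T = ∑ t ∈ T, (t.card + 1) := by
  rw [two_mul_art h, Finset.sum_add_distrib, area,
    Finset.card_biUnion fun s hs t ht hst => h.disjoint hs ht hst]
  simp

/-! ### Spreading and contracting -/

/-- The map of boxes that collapses the columns `s`, `s + 1` and `s + 2` to the column `s`. -/
def collapse (s : ℕ) (p : Box) : Box :=
  if p.1 ≤ s then p else if p.1 = s + 1 then (s, p.2 - 1) else (p.1 - 2, p.2)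

/-- The map of boxes that omits the columns `s + 1` and `s + 2`. -/
def skipColumns (s : ℕ) (p : Box) : Box := (if p.1 ≤ s then p.1 else p.1 + 2, p.2)

@[simp] theorem collapse_skipColumns (s : ℕ) (p : Box) : collapse s (skipColumns s p) = p := by
  obtain ⟨x, y⟩ := p
  simp only [collapse, skipColumns]
  grind

theorem skipColumns_injective (s : ℕ) : Function.Injective (skipColumns s) :=
  Function.LeftInverse.injective (collapse_skipColumns s)

/-- The boxes that collapse to `p`. -/
def fiber (s : ℕ) (p : Box) : Finset Box :=
  if p.1 < s then {p} else if p.1 = s then {(s, p.2), (s + 1, p.2 + 1), (s + 2, p.2)}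
    else {(p.1 + 2, p.2)}

theorem mem_fiber {s : ℕ} {p q : Box} : q ∈ fiber s p ↔ collapse s q = p := by
  obtain ⟨x, y⟩ := p
  obtain ⟨x', y'⟩ := q
  simp only [fiber, collapse]
  split_ifs <;> simp <;> omega

theorem card_fiber (s : ℕ) (p : Box) : (fiber s p).card = 1 + if p.1 = s then 2 else 0 := by
  simp only [fiber]
  split_ifs
  · omega
  · simp
  · rw [Finset.card_eq_three.2 ⟨_, _, _, _, _, _, rfl⟩] <;> simp
  · simp

/-- The tile `t` with each of its boxes in column `s` replaced by a peak. -/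
def spread (s : ℕ) (t : Finset Box) : Finset Box := t.biUnion (fiber s)

theorem mem_spread {s : ℕ} {t : Finset Box} {q : Box} : q ∈ spread s t ↔ collapse s q ∈ t := by
  simp [spread, mem_fiber]

theorem spread_injective (s : ℕ) : Function.Injective (spread s) := by
  intro t u h
  ext p
  rw [← collapse_skipColumns s p, ← mem_spread, h, mem_spread]

theorem card_spread (s : ℕ) (t : Finset Box) :
    (spread s t).card = t.card + 2 * (t.filter fun p => p.1 = s).card := by
  rw [spread, Finset.card_biUnion, Finset.sum_congr rfl fun p _ => card_fiber s p,
    Finset.sum_add_distrib, ← Finset.sum_filter]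
  · simp [mul_comm]
  · intro p _ q _ hpq
    refine Finset.disjoint_left.2 fun r hp hq => hpq ?_
    rw [mem_fiber] at hp hq
    exact hp.symm.trans hq

/-- The tile `t` with the columns `s + 1` and `s + 2` removed. -/
noncomputable def contract (s : ℕ) (t : Finset Box) : Finset Box :=
  t.preimage (skipColumns s) (skipColumns_injective s).injOn

theorem mem_contract {s : ℕ} {t : Finset Box} {p : Box} :
    p ∈ contract s t ↔ skipColumns s p ∈ t := by
  rw [contract, Finset.mem_preimage]

/-- In the columns `s`, `s + 1` and `s + 2` the tile `t` has peaks. -/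
def IsSaturated (s : ℕ) (t : Finset Box) : Prop :=
  ∀ y, ((s, y) ∈ t ↔ (s + 1, y + 1) ∈ t) ∧ ((s, y) ∈ t ↔ (s + 2, y) ∈ t)

theorem IsSaturated.spread_contract {s : ℕ} {t : Finset Box} (h : IsSaturated s t) :
    spread s (contract s t) = t := by
  ext ⟨x, y⟩
  rw [mem_spread, mem_contract]
  rcases lt_or_ge s x with hx | hx
  · rcases Nat.lt_or_ge (s + 2) x with hx' | hx'
    · simp only [collapse, skipColumns]
      rw [if_neg (show ¬ x ≤ s by omega), if_neg (show ¬ x = s + 1 by omega),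
        if_neg (show ¬ x - 2 ≤ s by omega), Nat.sub_add_cancel (by omega)]
    · obtain rfl | rfl : x = s + 1 ∨ x = s + 2 := by omega
      · have := (h (y - 1)).1
        simpa [collapse, skipColumns] using this
      · have := (h y).2
        simpa [collapse, skipColumns] using this
  · simp [collapse, skipColumns, hx]

theorem IsDyckTile.spread {t : Finset Box} (h : IsDyckTile t) (s : ℕ) :
    IsDyckTile (spread s t) := by
  obtain ⟨a, e, f, H⟩ := isDyckTile_iff.1 h
  -- A tile that meets column `s`, even only at an end, keeps its first column and becomes two
  -- columns longer.
  refine isDyckTile_iff.2 ⟨if a ≤ s then a else a + 2, if e < s then e else e + 2,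
    fun x => if x ≤ s then f x else if x = s + 1 then f s + 1 else f (x - 2), ?_, ?_, ?_, ?_, ?_⟩
  · have := H.le
    split_ifs <;> omega
  · have h1 := H.ends
    have h2 := H.le
    split_ifs <;> grind
  · intro x h1 h2
    rcases lt_trichotomy x s with hx | rfl | hx
    · have := H.step x (by grind) (by grind)
      simp only [if_pos hx.le, if_pos (show x + 1 ≤ s by omega)]
      exact this
    · simp
    · rcases (show s + 1 ≤ x from hx).eq_or_lt with rfl | hx'
      · simp
      · have := H.step (x - 2) (by grind) (by grind)
        rw [show x - 2 + 1 = x + 1 - 2 by omega] at this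
        simp only [if_neg (show ¬ x ≤ s by omega), if_neg (show ¬ x = s + 1 by omega),
          if_neg (show ¬ x + 1 ≤ s by omega), if_neg (show ¬ x + 1 = s + 1 by omega)]
        exact this
  · intro x h1 h2
    have ha : (if (if a ≤ s then a else a + 2) ≤ s then f (if a ≤ s then a else a + 2)
        else if (if a ≤ s then a else a + 2) = s + 1 then f s + 1
        else f ((if a ≤ s then a else a + 2) - 2)) = f a := by
      split_ifs <;> first | rfl | omega
    rw [ha]
    split_ifs at h1 h2 ⊢ <;> first | exact H.base _ (by omega) (by omega) | skip
    all_goals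
      have := H.base s (by omega) (by omega)
      omega
  · intro x y
    rw [mem_spread, collapse]
    dsimp only
    split_ifs <;> rw [H.mem] <;> grind

theorem IsDyckTile.contract {t : Finset Box} (h : IsDyckTile t) {s : ℕ} (hs : IsSaturated s t) :
    IsDyckTile (contract s t) := by
  obtain ⟨a, e, f, H⟩ := isDyckTile_iff.1 h
  have s0 : ∀ y, (a ≤ s ∧ s ≤ e ∧ y = f s) ↔ (a ≤ s + 1 ∧ s + 1 ≤ e ∧ y + 1 = f (s + 1)) := by
    intro y
    rw [← H.mem, ← H.mem]
    exact (hs y).1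
  have s1 : ∀ y, (a ≤ s ∧ s ≤ e ∧ y = f s) ↔ (a ≤ s + 2 ∧ s + 2 ≤ e ∧ y = f (s + 2)) := by
    intro y
    rw [← H.mem, ← H.mem]
    exact (hs y).2
  -- A saturated tile meets all of the columns `s`, `s + 1`, `s + 2` or none, so it neither starts
  -- nor ends in the middle of them.
  have ha : a ≤ s ∨ s + 3 ≤ a := by
    have h1 := s0 (f (s + 1) - 1)
    have h2 := s1 (f (s + 2))
    have := H.le
    by_contra
    rcases (show a = s + 1 ∨ a = s + 2 by omega) with rfl | rfl
    · have := h1.2 ⟨by omega, by omega, by omega⟩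
      omega
    · have := h2.2 ⟨by omega, by omega, by omega⟩
      omega
  have he : e < s ∨ s + 2 ≤ e := by
    have h1 := s1 (f s)
    have h2 := s0 (f (s + 1) - 1)
    have := H.le
    by_contra
    rcases (show e = s ∨ e = s + 1 by omega) with rfl | rfl
    · have := h1.1 ⟨by omega, by omega, by omega⟩
      omega
    · have := h1.1 ⟨by omega, by omega, by omega⟩
      omega
  refine isDyckTile_iff.2 ⟨if a ≤ s then a else a - 2, if e < s then e else e - 2,
    fun x => f (if x ≤ s then x else x + 2), ?_, ?_, ?_, ?_, ?_⟩
  · have := H.le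
    split_ifs <;> omega
  -- If the last column of the tile is deleted, column `s` becomes its end, at the same height.
  · have hpeak : e = s + 2 → f s = f (s + 2) := by
      intro h0
      have := (s1 (f (s + 2))).2 ⟨by have := H.le; omega, by omega, rfl⟩
      exact this.2.2.symm
    have h1 := H.ends
    have h2 := H.le
    have ea : (if (if a ≤ s then a else a - 2) ≤ s then (if a ≤ s then a else a - 2)
        else (if a ≤ s then a else a - 2) + 2) = a := by
      split_ifs <;> omega
    rw [ea]
    rcases eq_or_ne e (s + 2) with h0 | h0
    · rw [if_neg (show ¬ e < s by omega), if_pos (show e - 2 ≤ s by omega),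
        show e - 2 = s by omega, hpeak h0, ← h0, h1]
    · have ee : (if (if e < s then e else e - 2) ≤ s then (if e < s then e else e - 2)
          else (if e < s then e else e - 2) + 2) = e := by
        split_ifs <;> omega
      rw [ee, h1]
  · intro x h1 h2
    rcases lt_trichotomy x s with hx | rfl | hx
    · have := H.step x (by grind) (by grind)
      simp only [if_pos hx.le, if_pos (show x + 1 ≤ s by omega)]
      exact this
    · have e1 := (s1 (f x)).1 ⟨by grind, by grind, rfl⟩
      have := H.step (x + 2) (by grind) (by grind)
      simp only [if_pos le_rfl, if_neg (show ¬ x + 1 ≤ x by omega)]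
      rw [e1.2.2]
      exact this
    · have := H.step (x + 2) (by grind) (by grind)
      simp only [if_neg (show ¬ x ≤ s by omega), if_neg (show ¬ x + 1 ≤ s by omega)]
      exact this
  · intro x h1 h2
    have ea : (if (if a ≤ s then a else a - 2) ≤ s then (if a ≤ s then a else a - 2)
        else (if a ≤ s then a else a - 2) + 2) = a := by
      split_ifs <;> omega
    rw [ea]
    apply H.base <;> grind
  · intro x y
    rw [mem_contract, skipColumns, H.mem]
    grind

/-! ### Growth of tilings -/

/-- The path `up₂` arises from `up` by inserting a step `D` at position `s` and then a step `U`
at the beginning. -/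
structure IsGrowth (s : ℕ) (up up₂ : DyckWord) : Prop where
  semilength : up₂.semilength = up.semilength + 1
  left : ∀ x ≤ s, height up₂ (x + 1) = height up x + 1
  right : ∀ x, s ≤ x → height up₂ (x + 2) = height up x

theorem exists_isGrowth {s : ℕ} {up : DyckWord} (hs : s ≤ 2 * up.semilength) :
    ∃ up₂, IsGrowth s up up₂ := by
  have H := isDyckFun_height up
  have K : IsDyckFun (up.semilength + 1) fun x =>
      if x = 0 then 0 else if x ≤ s + 1 then height up (x - 1) + 1 else height up (x - 2) := by
    refine ⟨by simp, ?_, ?_, ?_⟩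
    · intro x hx
      rcases Nat.eq_zero_or_pos x with rfl | h0
      · simp [H.zero]
      · rcases lt_trichotomy x (s + 1) with h | rfl | h
        · have := H.step (x - 1) (by omega)
          rw [show x - 1 + 1 = x by omega] at this
          simp only [show x + 1 - 1 = x by omega]
          grind
        · simp
        · have := H.step (x - 2) (by omega)
          rw [show x - 2 + 1 = x + 1 - 2 by omega] at this
          grind
    · intro x
      have := H.nonneg (x - 1)
      have := H.nonneg (x - 2)
      grind
    · intro x hx
      have := H.tail (x - 2) (by omega)
      grind
  obtain ⟨w, h1, h2⟩ := K.exists_dyckWord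
  refine ⟨w, h1, fun x hx => ?_, fun x hx => ?_⟩
  · rw [h2]
    simp [hx]
  · rw [h2]
    simp only [show x + 2 - 2 = x by omega]
    grind

theorem IsGrowth.up_unique {s : ℕ} {up up' up₂ : DyckWord} (h : IsGrowth s up up₂)
    (h' : IsGrowth s up' up₂) : up = up' := by
  refine height_injective (by have := h.semilength; have := h'.semilength; omega) (funext fun x => ?_)
  rcases le_total x s with hx | hx
  · have := h.left x hx
    have := h'.left x hx
    omega
  · rw [← h.right x hx, ← h'.right x hx]

/-- The boxes between the spread of `up` at `s` and the growth of `up` at `s`. -/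
def stripBoxes (s : ℕ) (up : DyckWord) : Finset Box :=
  ((Finset.range s).filter fun i => height up (i + 1) < height up i).image fun i =>
    (i + 1, height up (i + 1) + 1)

theorem mem_stripBoxes {s : ℕ} {up : DyckWord} {x : ℕ} {y : ℤ} :
    (x, y) ∈ stripBoxes s up ↔
      ∃ i < s, x = i + 1 ∧ height up (i + 1) < height up i ∧ y = height up (i + 1) + 1 := by
  simp only [stripBoxes, Finset.mem_image, Finset.mem_filter, Finset.mem_range, Prod.mk.injEq]
  constructor
  · rintro ⟨i, ⟨h1, h2⟩, rfl, rfl⟩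
    exact ⟨i, h1, rfl, h2, rfl⟩
  · rintro ⟨i, h1, rfl, h2, rfl⟩
    exact ⟨i, ⟨h1, h2⟩, rfl, rfl⟩

/-- Spread the tiling `T` at `s` and add the boxes of the strip as tiles. -/
def growth (s : ℕ) (up : DyckWord) (T : Finset (Finset Box)) : Finset (Finset Box) :=
  T.image (spread s) ∪ (stripBoxes s up).image fun p => {p}

theorem mem_growth {s : ℕ} {up : DyckWord} {T : Finset (Finset Box)} {t : Finset Box} :
    t ∈ growth s up T ↔ (∃ u ∈ T, spread s u = t) ∨ ∃ p ∈ stripBoxes s up, {p} = t := by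
  simp [growth]

theorem IsPeak.height_succ {w : DyckWord} {s : ℕ} (h : IsPeak w s) :
    height w (s + 1) = height w s + 1 :=
  ((isPeak_iff_height h.lt).1 h).1

theorem IsPeak.height_erasePeak_left {w : DyckWord} {s x : ℕ} (h : IsPeak w s) (hx : x ≤ s) :
    height (erasePeak w s) x = height w x := by
  rw [h.height_erasePeak, if_pos hx]

theorem IsPeak.height_erasePeak_right {w : DyckWord} {s x : ℕ} (h : IsPeak w s) (hx : s ≤ x) :
    height (erasePeak w s) x = height w (x + 2) := by
  rw [h.height_erasePeak]
  split_ifs with hx'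
  · obtain rfl := le_antisymm hx hx'
    exact ((isPeak_iff_height h.lt).1 h).2.symm
  · rfl

theorem LiesBelow.growth {lo up up₂ : DyckWord} {s : ℕ} (hs : IsPeak lo s)
    (h : LiesBelow (erasePeak lo s) up) (g : IsGrowth s up up₂) : LiesBelow lo up₂ := by
  refine ⟨by rw [g.semilength, ← h.1, hs.semilength_erasePeak], fun x => ?_⟩
  rcases le_or_gt x (s + 1) with hx | hx
  · rcases Nat.eq_zero_or_pos x with rfl | h0
    · rw [(isDyckFun_height lo).zero, (isDyckFun_height up₂).zero]
    · obtain ⟨i, rfl⟩ : ∃ i, x = i + 1 := ⟨x - 1, by omega⟩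
      rw [g.left i (by omega)]
      have h1 := h.2 i
      rw [hs.height_erasePeak_left (by omega)] at h1
      have := (isDyckFun_height lo).step i (by have := hs.lt; omega)
      omega
  · obtain ⟨i, rfl⟩ : ∃ i, x = i + 2 := ⟨x - 2, by omega⟩
    rw [g.right i (by omega), ← hs.height_erasePeak_right (by omega)]
    exact h.2 i

section

variable {lo up up₂ : DyckWord} {s : ℕ}

theorem collapse_not_mem_of_mem_strip (h : LiesBelow lo up) {p : Box}
    (hp : p ∈ stripBoxes s up) : collapse s p ∉ skewShape lo up := by
  obtain ⟨x, y⟩ := p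
  obtain ⟨i, hi, rfl, h1, rfl⟩ := mem_stripBoxes.1 hp
  rw [collapse, if_pos (show i + 1 ≤ s by omega), mem_skewShape h]
  omega

/-- To the left of `s` one has `up₂ (i + 1) = up i + 1`, which is `up (i + 1)` at an up step of `up`
and `up (i + 1) + 2` at a down step. Hence each down step adds exactly one box on top of its column.
-/
theorem mem_skewShape_growth (hs : IsPeak lo s) (h : LiesBelow (erasePeak lo s) up)
    (g : IsGrowth s up up₂) {p : Box} : p ∈ skewShape lo up₂ ↔
      collapse s p ∈ skewShape (erasePeak lo s) up ∨ p ∈ stripBoxes s up := by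
  obtain ⟨x, y⟩ := p
  have hlt := hs.lt
  have hlen := hs.semilength_erasePeak
  have hup := h.1
  rw [mem_skewShape (h.growth hs g), mem_stripBoxes]
  rcases le_or_gt x s with hx | hx
  · rw [collapse, if_pos hx, mem_skewShape h, hs.height_erasePeak_left hx]
    rcases Nat.eq_zero_or_pos x with rfl | h0
    · simp only [(isDyckFun_height lo).zero, (isDyckFun_height up₂).zero, (isDyckFun_height up).zero]
      simp
    · obtain ⟨i, rfl⟩ : ∃ i, x = i + 1 := ⟨x - 1, by omega⟩
      rw [g.left i (by omega)]
      have h1 := (isDyckFun_height up).step i (by omega)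
      have h2 := h.even_sub (i + 1)
      have h3 := h.2 (i + 1)
      rw [hs.height_erasePeak_left hx, Int.even_iff] at h2
      rw [hs.height_erasePeak_left hx] at h3
      simp only [Int.odd_iff]
      constructor
      · rintro ⟨h4, h5, h6⟩
        by_cases h7 : y < height up (i + 1)
        · exact Or.inl ⟨h4, h7, h6⟩
        · exact Or.inr ⟨i, by omega, rfl, by omega, by omega⟩
      · rintro (h4 | ⟨j, hj, e, h4, h5⟩)
        · omega
        · obtain rfl : i = j := by omega
          omega
  · have no_strip : ¬ ∃ i < s, x = i + 1 ∧ height up (i + 1) < height up i ∧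
        y = height up (i + 1) + 1 := by
      rintro ⟨i, hi, rfl, -⟩
      omega
    rw [or_iff_left no_strip, collapse, if_neg (show ¬ x ≤ s by omega)]
    split_ifs with hx'
    · dsimp only at hx'
      subst hx'
      rw [mem_skewShape h, hs.height_erasePeak_left le_rfl, g.left s le_rfl, hs.height_succ,
        show y - (height lo s + 1) = y - 1 - height lo s by ring]
      constructor <;> rintro ⟨h1, h2, h3⟩ <;> exact ⟨by omega, by omega, h3⟩
    · dsimp only at hx'
      obtain ⟨i, rfl⟩ : ∃ i, x = i + 2 := ⟨x - 2, by omega⟩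
      rw [show i + 2 - 2 = i by omega, mem_skewShape h, hs.height_erasePeak_right (by omega),
        g.right i (by omega)]

theorem collapse_height (hs : IsPeak lo s) (p : Box) (y : ℤ) :
    p.2 - y < height lo p.1 ↔
      (collapse s p).2 - y < height (erasePeak lo s) (collapse s p).1 := by
  obtain ⟨x, z⟩ := p
  simp only [collapse]
  split_ifs with h1 h2
  · rw [hs.height_erasePeak_left h1]
  · subst h2
    rw [hs.height_erasePeak_left le_rfl, hs.height_succ]
    dsimp only
    omega
  · rw [hs.height_erasePeak_right (by omega), show x - 2 + 2 = x by omega]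

theorem collapse_down (s : ℕ) (p : Box) (y : ℤ) :
    collapse s (p.1, p.2 - y) = ((collapse s p).1, (collapse s p).2 - y) := by
  simp only [collapse]
  split_ifs
  · rfl
  · simp
    ring
  · rfl

/-- Below a strip box comes the top box of the column under `up`, if that column has a box at all.
-/
theorem strip_down_mem (hs : IsPeak lo s) (h : LiesBelow (erasePeak lo s) up) {p : Box}
    (hp : p ∈ stripBoxes s up) : p.2 - 2 < height lo p.1 ∨
      collapse s (p.1, p.2 - 2) ∈ skewShape (erasePeak lo s) up := by
  obtain ⟨x, y⟩ := p
  obtain ⟨i, hi, rfl, h1, rfl⟩ := mem_stripBoxes.1 hp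
  have h2 := h.even_sub (i + 1)
  rw [collapse, if_pos (show i + 1 ≤ s by omega), mem_skewShape h]
  rw [hs.height_erasePeak_left (by omega)] at *
  rw [Int.odd_iff]
  rw [Int.even_iff] at h2
  dsimp only
  omega

variable {T : Finset (Finset Box)}

theorem IsDyckTiling.growth (hs : IsPeak lo s) (hT : IsDyckTiling (erasePeak lo s) up T)
    (g : IsGrowth s up up₂) : IsDyckTiling lo up₂ (growth s up T) := by
  have h := hT.below
  rw [isDyckTiling_iff]
  refine ⟨h.growth hs g, ?_, ?_, ?_⟩
  · intro t ht
    rcases mem_growth.1 ht with ⟨u, hu, rfl⟩ | ⟨p, hp, rfl⟩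
    · exact (hT.tile u hu).spread s
    · exact isDyckTile_singleton p
  · intro t₁ h₁ t₂ h₂ p p₁ p₂
    rcases mem_growth.1 h₁ with ⟨u₁, hu₁, rfl⟩ | ⟨q₁, hq₁, rfl⟩ <;>
      rcases mem_growth.1 h₂ with ⟨u₂, hu₂, rfl⟩ | ⟨q₂, hq₂, rfl⟩
    · rw [mem_spread] at p₁ p₂
      rw [hT.eq_of_mem hu₁ hu₂ p₁ p₂]
    · rw [mem_spread] at p₁
      rw [Finset.mem_singleton] at p₂
      subst p₂
      exact absurd (hT.mem_skewShape hu₁ p₁) (collapse_not_mem_of_mem_strip h hq₂)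
    · rw [mem_spread] at p₂
      rw [Finset.mem_singleton] at p₁
      subst p₁
      exact absurd (hT.mem_skewShape hu₂ p₂) (collapse_not_mem_of_mem_strip h hq₁)
    · rw [Finset.mem_singleton] at p₁ p₂
      rw [← p₁, ← p₂]
  · intro p
    rw [mem_skewShape_growth hs h g, ← hT.exists_mem_iff]
    constructor
    · rintro ⟨t, ht, hp⟩
      rcases mem_growth.1 ht with ⟨u, hu, rfl⟩ | ⟨q, hq, rfl⟩
      · exact Or.inl ⟨u, hu, mem_spread.1 hp⟩
      · rw [Finset.mem_singleton] at hp
        exact Or.inr (hp ▸ hq)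
    · rintro (⟨u, hu, hp⟩ | hp)
      · exact ⟨spread s u, mem_growth.2 (Or.inl ⟨u, hu, rfl⟩), mem_spread.2 hp⟩
      · exact ⟨{p}, mem_growth.2 (Or.inr ⟨p, hp, rfl⟩), Finset.mem_singleton_self p⟩

/-- Collapsing commutes with downward translation and preserves the position relative to the lower
path, so spread tiles inherit the property; strip boxes rest on spread tiles or on `lo`. -/
theorem IsCoverInclusive.growth (hs : IsPeak lo s) (hT : IsDyckTiling (erasePeak lo s) up T)
    (hc : IsCoverInclusive (erasePeak lo s) T) : IsCoverInclusive lo (growth s up T) := by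
  rw [isCoverInclusive_iff] at hc ⊢
  intro t ht
  rcases mem_growth.1 ht with ⟨u, hu, rfl⟩ | ⟨p, hp, rfl⟩
  · rcases hc u hu with h | ⟨v, hv, hne, hvu⟩
    · left
      intro p hp
      rw [collapse_height hs]
      exact h _ (mem_spread.1 hp)
    · right
      refine ⟨spread s v, mem_growth.2 (Or.inl ⟨v, hv, rfl⟩), (spread_injective s).ne hne, ?_⟩
      intro p hp
      rw [mem_spread, collapse_down]
      exact hvu _ (mem_spread.1 hp)
  · rcases strip_down_mem hs hT.below hp with h | h
    · left
      intro q hq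
      rwa [Finset.mem_singleton.1 hq]
    · right
      obtain ⟨u, hu, hpu⟩ := hT.exists_mem_iff.2 h
      refine ⟨spread s u, mem_growth.2 (Or.inl ⟨u, hu, rfl⟩), ?_, ?_⟩
      · intro e
        have hp' : p ∈ spread s u := by
          rw [e]
          exact Finset.mem_singleton_self p
        exact collapse_not_mem_of_mem_strip hT.below hp
          (hT.mem_skewShape hu (mem_spread.1 hp'))
      · intro q hq
        rw [Finset.mem_singleton.1 hq, mem_spread]
        exact hpu

theorem disjoint_growth (hT : IsDyckTiling lo up T) :
    Disjoint (T.image (spread s)) ((stripBoxes s up).image fun p => {p}) := by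
  rw [Finset.disjoint_left]
  intro t h1 h2
  obtain ⟨u, hu, rfl⟩ := Finset.mem_image.1 h1
  obtain ⟨p, hp, e⟩ := Finset.mem_image.1 h2
  have hp' : p ∈ spread s u := by
    rw [← e]
    exact Finset.mem_singleton_self p
  exact collapse_not_mem_of_mem_strip hT.below hp (hT.mem_skewShape hu (mem_spread.1 hp'))

/-- The region of the grown tiling determines its upper path, hence `up` and the strip; without the
strip, spreading is injective. -/
theorem growth_injective (hs : IsPeak lo s) {up' : DyckWord} {T' : Finset (Finset Box)}
    (hT : IsDyckTiling (erasePeak lo s) up T) (hT' : IsDyckTiling (erasePeak lo s) up' T')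
    (h : growth s up T = growth s up' T') : T = T' := by
  have hle : ∀ {u : DyckWord}, LiesBelow (erasePeak lo s) u → s ≤ 2 * u.semilength := by
    intro u hu
    have := hu.1
    have := hs.semilength_erasePeak
    have := hs.lt
    omega
  obtain ⟨w, g⟩ := exists_isGrowth (hle hT.below)
  obtain ⟨w', g'⟩ := exists_isGrowth (hle hT'.below)
  have k := hT.growth hs g
  have k' := hT'.growth hs g'
  rw [← h] at k'
  obtain rfl := k.up_unique k'
  obtain rfl := g.up_unique g'
  have e : T.image (spread s) = T'.image (spread s) := by
    rw [← Finset.union_sdiff_cancel_right (disjoint_growth hT),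
      ← Finset.union_sdiff_cancel_right (disjoint_growth hT')]
    exact congrArg (· \ (stripBoxes s up).image fun p => {p}) h
  exact Finset.image_injective (spread_injective s) e

/-! ### The change of `art` under growth -/

theorem two_mul_card_descents {w : DyckWord} {s : ℕ} (hs : s ≤ 2 * w.semilength) :
    2 * (((Finset.range s).filter fun i => height w (i + 1) < height w i).card : ℤ) =
      s - height w s := by
  induction s with
  | zero => simp [(isDyckFun_height w).zero]
  | succ s ih =>
    have := ih (by omega)
    have h := (isDyckFun_height w).step s (by omega)
    rw [Finset.range_add_one, Finset.filter_insert]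
    split_ifs
    · rw [Finset.card_insert_of_notMem (by simp)]
      push_cast
      omega
    · push_cast
      omega

theorem card_stripBoxes (s : ℕ) (up : DyckWord) : (stripBoxes s up).card =
    ((Finset.range s).filter fun i => height up (i + 1) < height up i).card := by
  rw [stripBoxes, Finset.card_image_of_injective]
  intro i j h
  simpa using congrArg Prod.fst h

theorem card_filter_odd (a : ℤ) (k : ℕ) :
    ((Finset.Ioo a (a + 2 * k)).filter fun y => Odd (y - a)).card = k := by
  have : (Finset.Ioo a (a + 2 * k)).filter (fun y => Odd (y - a)) =
      (Finset.range k).image fun j : ℕ => a + 2 * j + 1 := by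
    ext y
    simp only [Finset.mem_filter, Finset.mem_Ioo, Finset.mem_image, Finset.mem_range]
    constructor
    · rintro ⟨⟨h1, h2⟩, m, hm⟩
      exact ⟨m.toNat, by omega, by omega⟩
    · rintro ⟨j, hj, rfl⟩
      exact ⟨by omega, j, by ring⟩
  rw [this, Finset.card_image_of_injective, Finset.card_range]
  intro i j h
  dsimp only at h
  omega

theorem two_mul_card_column {lo up : DyckWord} (h : LiesBelow lo up) (s : ℕ) :
    2 * (((skewShape lo up).filter fun p => p.1 = s).card : ℤ) = height up s - height lo s := by
  have e : (skewShape lo up).filter (fun p => p.1 = s) =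
      ((Finset.Ioo (height lo s) (height up s)).filter fun y => Odd (y - height lo s)).image
        fun y => (s, y) := by
    ext ⟨x, y⟩
    simp only [Finset.mem_filter, mem_skewShape h, Finset.mem_image, Finset.mem_Ioo, Prod.mk.injEq]
    constructor
    · rintro ⟨⟨h1, h2, h3⟩, rfl⟩
      exact ⟨y, ⟨⟨h1, h2⟩, h3⟩, rfl, rfl⟩
    · rintro ⟨y, ⟨⟨h1, h2⟩, h3⟩, rfl, rfl⟩
      exact ⟨⟨h1, h2, h3⟩, rfl⟩
  rw [e, Finset.card_image_of_injective _ (Prod.mk_right_injective s)]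
  obtain ⟨k, hk⟩ : ∃ k : ℕ, height up s = height lo s + 2 * k := by
    obtain ⟨m, hm⟩ := h.even_sub s
    have := h.2 s
    exact ⟨m.toNat, by omega⟩
  rw [hk, card_filter_odd]
  ring

/-- A box in column `s` adds two to the area, a strip box adds one box and one tile; each thus adds
one to `art`. The total (up(s) - lo(s))/2 + (s - up(s))/2 = (s - lo(s))/2 does not depend on `up`.
-/
theorem art_growth (hs : IsPeak lo s) (hT : IsDyckTiling (erasePeak lo s) up T) :
    art (growth s up T) = (lo.toList.take s).count D + art T := by
  have hlt := hs.lt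
  have hlen := hs.semilength_erasePeak
  have hup := hT.below.1
  obtain ⟨w, g⟩ := exists_isGrowth (show s ≤ 2 * up.semilength by omega)
  have e1 := (hT.growth hs g).two_mul_art_eq_sum
  rw [growth, Finset.sum_union (disjoint_growth hT),
    Finset.sum_image fun _ _ _ _ h => spread_injective s h,
    Finset.sum_image fun _ _ _ _ h => Finset.singleton_injective h] at e1
  simp only [card_spread, Finset.card_singleton, Finset.sum_const, smul_eq_mul] at e1
  have e2 : ∑ t ∈ T, (t.card + 2 * (t.filter fun p => p.1 = s).card + 1) =
      2 * art T + 2 * ((skewShape (erasePeak lo s) up).filter fun p => p.1 = s).card := by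
    rw [hT.two_mul_art_eq_sum, ← hT.cover, Finset.filter_biUnion, Finset.card_biUnion,
      Finset.mul_sum, ← Finset.sum_add_distrib]
    · exact Finset.sum_congr rfl fun t _ => by
        simp only [id]
        ring
    · intro t ht u hu htu
      exact Finset.disjoint_filter_filter (hT.disjoint ht hu htu)
  have e3 := two_mul_card_column hT.below s
  have e4 := two_mul_card_descents (show s ≤ 2 * up.semilength by omega)
  have e5 := two_mul_count_D_take (show s ≤ 2 * lo.semilength by omega)
  rw [hs.height_erasePeak_left le_rfl] at e3
  rw [e2, card_stripBoxes] at e1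
  rw [growth]
  omega

end

/-! ### Eligible peaks -/

/-- The peak of `lo` at `s` is eligible: above it the tiles have peaks, and to the right of it the
upper path goes down. -/
structure IsEligible (lo : DyckWord) (T : Finset (Finset Box)) (s : ℕ) : Prop where
  peak : IsPeak lo s
  right : ∀ t ∈ T, ∀ y, (s + 1, y + 1) ∈ t ↔ (s + 2, y) ∈ t
  left : ∀ t ∈ T, ∀ y, (s + 1, y + 1) ∈ t → (s, y) ∈ t

section

variable {lo up up₂ : DyckWord} {s : ℕ} {T : Finset (Finset Box)}

theorem IsEligible.height_succ (hT : IsDyckTiling lo up T) (h : IsEligible lo T s) :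
    height up (s + 2) = height up (s + 1) - 1 := by
  have hlt := h.peak.lt
  have hlen := hT.below.1
  refine ((isDyckFun_height up).step (s + 1) (by omega)).resolve_left fun hU => ?_
  rw [show s + 1 + 1 = s + 2 from rfl] at hU
  have hpk := (isPeak_iff_height hlt).1 h.peak
  have h1 := hT.below.2 (s + 1)
  have h2 := hT.below.even_sub (s + 1)
  -- After an up step this box would fit under `up`, but its partner in column `s + 1` would not.
  have hmem : (s + 2, height up (s + 1)) ∈ skewShape lo up := by
    rw [mem_skewShape hT.below, Int.odd_iff]
    rw [Int.even_iff] at h2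
    omega
  obtain ⟨t, ht, hp⟩ := hT.exists_mem_iff.2 hmem
  have := hT.mem_skewShape ht ((h.right t ht _).2 hp)
  rw [mem_skewShape hT.below] at this
  omega

/-- Spread tiles have full peaks at `s`, and the strip ends at column `s`. A strip box may occupy
column `s` alone, which is why `IsEligible.left` is only an implication. -/
theorem isEligible_growth (hs : IsPeak lo s) : IsEligible lo (growth s up T) s := by
  refine ⟨hs, fun t ht y => ?_, fun t ht y hy => ?_⟩
  · rcases mem_growth.1 ht with ⟨u, hu, rfl⟩ | ⟨⟨x, z⟩, hp, rfl⟩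
    · simp [mem_spread, collapse]
    · obtain ⟨i, hi, rfl, -⟩ := mem_stripBoxes.1 hp
      simp only [Finset.mem_singleton, Prod.mk.injEq]
      omega
  · rcases mem_growth.1 ht with ⟨u, hu, rfl⟩ | ⟨⟨x, z⟩, hp, rfl⟩
    · simpa [mem_spread, collapse] using hy
    · obtain ⟨i, hi, rfl, -⟩ := mem_stripBoxes.1 hp
      simp only [Finset.mem_singleton, Prod.mk.injEq] at hy
      omega

/-- Eligibility of `s'` forces a down step of `up` at `s'`, hence a strip box in column `s' + 1`; a
single box cannot extend to column `s'`. -/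
theorem not_isEligible_growth (hs : IsPeak lo s) (hT : IsDyckTiling (erasePeak lo s) up T) {s' : ℕ}
    (hs' : s' < s) : ¬ IsEligible lo (growth s up T) s' := by
  intro h
  have hlt := hs.lt
  have hlen := hs.semilength_erasePeak
  have hup := hT.below.1
  obtain ⟨w, g⟩ := exists_isGrowth (show s ≤ 2 * up.semilength by omega)
  have hG := hT.growth hs g
  have hne : s ≠ s' + 1 := by
    rintro rfl
    have := hs.1
    rw [h.peak.2] at this
    cases this
  have h1 := h.height_succ hG
  rw [g.left s' (by omega), show s' + 2 = s' + 1 + 1 from rfl, g.left (s' + 1) (by omega)] at h1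
  have hp : (s' + 1, height up (s' + 1) + 1) ∈ stripBoxes s up :=
    mem_stripBoxes.2 ⟨s', hs', rfl, by omega, rfl⟩
  have := h.left _ (mem_growth.2 (Or.inr ⟨_, hp, rfl⟩)) (height up (s' + 1))
    (Finset.mem_singleton_self _)
  rw [Finset.mem_singleton, Prod.mk.injEq] at this
  omega

/-- If the topmost tile in a column has a peak there, then so do the tiles below it. -/
theorem isEligible_of_peak (hT : IsDyckTiling lo up T) (hc : IsCoverInclusive lo T)
    {t : Finset Box} (ht : t ∈ T) (hx : s + 1 < 2 * lo.semilength)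
    (h0 : (s, height up (s + 1) - 2) ∈ t) (h1 : (s + 1, height up (s + 1) - 1) ∈ t)
    (h2 : (s + 2, height up (s + 1) - 2) ∈ t) (hD : height up (s + 2) = height up (s + 1) - 1) :
    IsEligible lo T s := by
  have hb := hT.below
  rw [isCoverInclusive_iff] at hc
  have par : ∀ x, (height up x - height lo x) % 2 = 0 := fun x => Int.even_iff.1 (hb.even_sub x)
  have box : ∀ u ∈ T, ∀ x y, (x, y) ∈ u →
      height lo x < y ∧ y < height up x ∧ (y - height lo x) % 2 = 1 := by
    intro u hu x y hy
    have := hT.mem_skewShape hu hy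
    rwa [mem_skewShape hb, Int.odd_iff] at this
  -- Cover-inclusiveness hands the peak down: while the middle box is not the lowest of its column,
  -- the next tile contains the translate of the whole tile.
  have peaks : ∀ k : ℕ, height lo (s + 1) < height up (s + 1) - 1 - 2 * k →
      ∃ u ∈ T, (s, height up (s + 1) - 2 - 2 * k) ∈ u ∧
        (s + 1, height up (s + 1) - 1 - 2 * k) ∈ u ∧
        (s + 2, height up (s + 1) - 2 - 2 * k) ∈ u := by
    intro k
    induction k with
    | zero =>
      intro _
      refine ⟨t, ht, ?_⟩
      simpa using ⟨h0, h1, h2⟩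
    | succ k ih =>
      intro hk
      push_cast at hk
      obtain ⟨u, hu, u0, u1, u2⟩ := ih (by omega)
      rcases hc u hu with hlow | ⟨v, hv, -, hvu⟩
      · have := hlow _ u1
        dsimp only at this
        omega
      · refine ⟨v, hv, ?_⟩
        have v0 := hvu _ u0
        have v1 := hvu _ u1
        have v2 := hvu _ u2
        push_cast
        ring_nf at v0 v1 v2 ⊢
        exact ⟨v0, v1, v2⟩
  have b1 := box t ht _ _ h1
  have p1 := par (s + 1)
  obtain ⟨k, hk⟩ : ∃ k : ℕ, height up (s + 1) = height lo (s + 1) + 2 + 2 * k :=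
    ⟨((height up (s + 1) - height lo (s + 1) - 2) / 2).toNat, by omega⟩
  have stepL := (isDyckFun_height lo).step s (by omega)
  have stepR := (isDyckFun_height lo).step (s + 1) hx
  -- For this `k` the middle box is the lowest in its column, and its neighbours have centres at the
  -- height of `lo` at `s + 1`; as they lie above `lo`, the path `lo` is lower at `s` and `s + 2`.
  have hpk : IsPeak lo s := by
    rw [isPeak_iff_height hx]
    obtain ⟨u, hu, u0, u1, u2⟩ := peaks k (by omega)
    have c0 := box u hu _ _ u0
    have c2 := box u hu _ _ u2
    rw [show s + 1 + 1 = s + 2 from rfl] at stepR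
    omega
  have hpk' := (isPeak_iff_height hx).1 hpk
  have column : ∀ u ∈ T, ∀ y, (s + 1, y + 1) ∈ u → (s, y) ∈ u ∧ (s + 2, y) ∈ u := by
    intro u hu y hy
    have b := box u hu _ _ hy
    obtain ⟨j, hj⟩ : ∃ j : ℕ, y = height up (s + 1) - 2 - 2 * j :=
      ⟨((height up (s + 1) - 2 - y) / 2).toNat, by omega⟩
    obtain ⟨v, hv, v0, v1, v2⟩ := peaks j (by omega)
    rw [hj] at hy ⊢
    rw [show height up (s + 1) - 2 - 2 * (j : ℤ) + 1 = height up (s + 1) - 1 - 2 * j by ring] at hy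
    rw [hT.eq_of_mem hu hv hy v1]
    exact ⟨v0, v2⟩
  refine ⟨hpk, fun u hu y => ⟨fun h => (column u hu y h).2, fun h => ?_⟩,
    fun u hu y h => (column u hu y h).1⟩
  have b := box u hu _ _ h
  have hmem : (s + 1, y + 1) ∈ skewShape lo up := by
    rw [mem_skewShape hb, Int.odd_iff]
    omega
  obtain ⟨v, hv, hvy⟩ := hT.exists_mem_iff.2 hmem
  rwa [hT.eq_of_mem hu hv h (column v hv y hvy).2]

theorem isEligible_of_empty (hT : IsDyckTiling lo up T) (hs : IsPeak lo s)
    (he : height up (s + 1) = height lo (s + 1))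
    (hD : height up (s + 2) = height up (s + 1) - 1) : IsEligible lo T s := by
  have hpk := (isPeak_iff_height hs.lt).1 hs
  have n1 : ∀ u ∈ T, ∀ y, (s + 1, y) ∉ u := by
    intro u hu y h
    have := hT.mem_skewShape hu h
    rw [mem_skewShape hT.below] at this
    omega
  have n2 : ∀ u ∈ T, ∀ y, (s + 2, y) ∉ u := by
    intro u hu y h
    have := hT.mem_skewShape hu h
    rw [mem_skewShape hT.below] at this
    omega
  exact ⟨hs, fun u hu y => iff_of_false (n1 u hu _) (n2 u hu _), fun u hu y h => absurd h (n1 u hu _)⟩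

/-- Below a down step of the upper path there is a tile that is a single box, unless some peak
to the left of it is eligible. -/
theorem singleton_mem_or_exists_isEligible (hT : IsDyckTiling lo up T)
    (hc : IsCoverInclusive lo T) (x : ℕ) (hx : x < 2 * lo.semilength)
    (hD : height up (x + 1) = height up x - 1) :
    {(x, height up x - 1)} ∈ T ∨ ∃ s < x, IsEligible lo T s := by
  have hb := hT.below
  have hup := isDyckFun_height up
  have hlo := isDyckFun_height lo
  induction x with
  | zero =>
    have := hup.nonneg (0 + 1)
    have := hup.zero
    omega
  | succ x ih =>
    rw [show x + 1 + 1 = x + 2 from rfl] at hD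
    have stepU := hup.step x (by have := hb.1; omega)
    have stepL := hlo.step x (by omega)
    have stepL' := hlo.step (x + 1) hx
    rw [show x + 1 + 1 = x + 2 from rfl] at stepL'
    have l0 := hb.2 x
    have l1 := hb.2 (x + 1)
    have l2 := hb.2 (x + 2)
    rcases eq_or_lt_of_le l1 with he | hlt
    · by_cases hpk : IsPeak lo x
      · exact Or.inr ⟨x, by omega, isEligible_of_empty hT hpk he.symm hD⟩
      -- Here both paths descend from `x` to `x + 1` and meet at `x`, so the induction hypothesis
      -- finds no box there and yields an eligible peak.
      · rw [isPeak_iff_height hx] at hpk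
        rcases ih (by omega) (by omega) with h | ⟨s, hs, h⟩
        · have := hT.mem_skewShape h (Finset.mem_singleton_self _)
          rw [mem_skewShape hb] at this
          omega
        · exact Or.inr ⟨s, by omega, h⟩
    · have p1 := Int.even_iff.1 (hb.even_sub (x + 1))
      have hmem : (x + 1, height up (x + 1) - 1) ∈ skewShape lo up := by
        rw [mem_skewShape hb, Int.odd_iff]
        omega
      obtain ⟨t, ht, hp⟩ := hT.exists_mem_iff.2 hmem
      obtain ⟨a, e, f, H⟩ := isDyckTile_iff.1 (hT.tile t ht)
      have hp' := (H.mem _ _).1 hp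
      by_cases hae : a = e
      · left
        have : t = {(x + 1, height up (x + 1) - 1)} := by
          ext ⟨x', y'⟩
          rw [H.mem, Finset.mem_singleton, Prod.mk.injEq]
          constructor
          · rintro ⟨h1, h2, rfl⟩
            obtain rfl : x' = x + 1 := by omega
            exact ⟨rfl, hp'.2.2.symm⟩
          · rintro ⟨rfl, rfl⟩
            exact hp'
        rwa [← this]
      · have above : ∀ x' y', (x', y') ∈ t → y' < height up x' := by
          intro x' y' h
          have := hT.mem_skewShape ht h
          rw [mem_skewShape hb] at this
          exact this.2.1
        -- The tile touches `up` at `x + 1`, so it must follow the down step of `up`. In particular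
        -- it does not start at `x + 1`, since a Dyck path does not start downward.
        have next : x + 1 < e → f (x + 2) = f (x + 1) - 1 := by
          intro h
          refine (H.step (x + 1) hp'.1 h).resolve_left fun h' => ?_
          have := above (x + 2) (f (x + 2)) ((H.mem _ _).2 ⟨by omega, by omega, rfl⟩)
          rw [show x + 1 + 1 = x + 2 from rfl] at h'
          omega
        have hax : a ≤ x := by
          by_contra hax
          obtain rfl : a = x + 1 := by omega
          have := next (by omega)
          have := H.base (x + 2) (by omega) (by omega)
          omega
        have stepf := H.step x hax (by omega)
        have memx : (x, f x) ∈ t := (H.mem _ _).2 ⟨hax, by omega, rfl⟩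
        rcases stepf with hU | hU
        -- After an up step the tile is above its base level and cannot end; so it has a peak at `x
        -- + 1`.
        · have hxe : x + 1 < e := by
            by_contra hxe
            obtain rfl : e = x + 1 := by omega
            have := H.base x hax (by omega)
            have := H.ends
            omega
          right
          refine ⟨x, by omega, isEligible_of_peak hT hc ht hx ?_ hp ?_ hD⟩
          · rw [show height up (x + 1) - 2 = f x by omega]
            exact memx
          · refine (H.mem _ _).2 ⟨by omega, by omega, ?_⟩
            have := next hxe
            omega
        -- If the tile descends from `x`, then so does `up`, and the top box in column `x` lies in
        -- the same larger tile; this excludes the first alternative of the induction hypothesis.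
        · have := above _ _ memx
          rcases ih (by omega) (by omega) with h | ⟨s, hs, h⟩
          · exfalso
            have e1 : height up x - 1 = f x := by omega
            rw [e1] at h
            have := hT.eq_of_mem ht h memx (Finset.mem_singleton_self _)
            rw [this, Finset.mem_singleton, Prod.mk.injEq] at hp
            omega
          · exact Or.inr ⟨s, by omega, h⟩

/-- Under the last step of `up`, which descends from height 1 to 0, no box fits above `lo`. -/
theorem exists_isEligible (hT : IsDyckTiling lo up T) (hc : IsCoverInclusive lo T)
    (hlo : lo ≠ 0) : ∃ s, IsEligible lo T s := by
  have hpos : 0 < lo.semilength := by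
    rw [Nat.pos_iff_ne_zero]
    intro h
    have := length_toList lo
    rw [h] at this
    exact hlo (DyckWord.toList_eq_nil.1 (List.eq_nil_of_length_eq_zero this))
  have hlen := hT.below.1
  have hU := isDyckFun_height up
  obtain ⟨x, hx⟩ : ∃ x, x + 1 = 2 * lo.semilength := ⟨2 * lo.semilength - 1, by omega⟩
  have h1 := hU.tail (x + 1) (by omega)
  have h2 := hU.nonneg x
  have h3 := hU.step x (by omega)
  rcases singleton_mem_or_exists_isEligible hT hc x (by omega) (by omega) with h | ⟨s, -, h⟩
  · have := hT.mem_skewShape h (Finset.mem_singleton_self _)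
    rw [mem_skewShape hT.below] at this
    have := (isDyckFun_height lo).nonneg x
    omega
  · exact ⟨s, h⟩

/-! ### Every tiling is a growth -/

theorem exists_isGrowth_of_isEligible (hT : IsDyckTiling lo up₂ T) (hc : IsCoverInclusive lo T)
    (h : IsEligible lo T s) (hmin : ∀ s' < s, ¬ IsEligible lo T s') :
    ∃ up, LiesBelow (erasePeak lo s) up ∧ IsGrowth s up up₂ := by
  have hb := hT.below
  have hs := h.peak
  have hlt := hs.lt
  have hlen := hs.semilength_erasePeak
  have hlen₂ := hb.1
  have hU := isDyckFun_height up₂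
  have hL := isDyckFun_height (erasePeak lo s)
  have hD := h.height_succ hT
  have above : ∀ x, height (erasePeak lo s) x ≤
      if x < s then height up₂ (x + 1) - 1 else height up₂ (x + 2) := by
    intro x
    split_ifs with hx
    · rw [hs.height_erasePeak_left hx.le]
      have := hb.2 x
      rcases hU.step x (by omega) with h1 | h1
      · omega
      -- By minimality of `s` there is a box under this down step, so `up₂` is at least two above
      -- `lo` at `x` and can be lowered.
      · rcases singleton_mem_or_exists_isEligible hT hc x (by omega) h1 with h2 | ⟨s', h2, h3⟩
        · have := hT.mem_skewShape h2 (Finset.mem_singleton_self _)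
          rw [mem_skewShape hb] at this
          omega
        · exact absurd h3 (hmin s' (by omega))
    · rw [hs.height_erasePeak_right (by omega)]
      exact hb.2 _
  have K : IsDyckFun (erasePeak lo s).semilength fun x =>
      if x < s then height up₂ (x + 1) - 1 else height up₂ (x + 2) := by
    refine ⟨?_, ?_, fun x => (hL.nonneg x).trans (above x), ?_⟩
    · have h0 := hU.zero
      have h1 := hU.nonneg 1
      have h2 := hU.step 0 (by omega)
      have h3 := hU.nonneg 2
      rw [zero_add] at h2
      split_ifs with hx
      · rw [zero_add]
        omega
      · obtain rfl : s = 0 := by omega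
        rw [zero_add] at hD ⊢
        rw [zero_add] at hD
        omega
    · intro x hx
      rcases lt_trichotomy (x + 1) s with hx' | rfl | hx'
      · have := hU.step (x + 1) (by omega)
        rw [if_pos hx', if_pos (by omega)]
        omega
      · have := hU.step (x + 1) (by omega)
        rw [if_neg (by omega), if_pos (by omega)]
        rw [show x + 1 + 1 = x + 2 from rfl] at *
        omega
      · have := hU.step (x + 2) (by omega)
        rw [if_neg (by omega), if_neg (by omega)]
        exact this
    · intro x hx
      rw [if_neg (by omega)]
      exact hU.tail _ (by omega)
  obtain ⟨up, h1, h2⟩ := K.exists_dyckWord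
  refine ⟨up, ⟨h1.symm, fun x => ?_⟩, by omega, fun x hx => ?_, fun x hx => ?_⟩
  · rw [h2]
    exact above x
  · rw [h2]
    dsimp only
    split_ifs with hx'
    · ring
    · obtain rfl : x = s := by omega
      omega
  · rw [h2]
    dsimp only
    rw [if_neg (by omega)]

theorem singleton_mem_of_mem_strip (hT : IsDyckTiling lo up₂ T) (hc : IsCoverInclusive lo T)
    (g : IsGrowth s up up₂) (hs : s + 1 < 2 * lo.semilength) (hmin : ∀ s' < s, ¬ IsEligible lo T s')
    {p : Box} (hp : p ∈ stripBoxes s up) : {p} ∈ T := by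
  obtain ⟨x, y⟩ := p
  obtain ⟨i, hi, rfl, h1, rfl⟩ := mem_stripBoxes.1 hp
  have h2 := g.left i hi.le
  have h3 := g.left (i + 1) hi
  have h4 := (isDyckFun_height up).step i (by have := g.semilength; have := hT.below.1; omega)
  rcases singleton_mem_or_exists_isEligible hT hc (i + 1) (by omega) (by omega) with h5 | ⟨s', h5, h6⟩
  · rwa [show height up (i + 1) + 1 = height up₂ (i + 1) - 1 by omega]
  · exact absurd h6 (hmin s' (by omega))

/-- By minimality the strip boxes are tiles of `T`. Without them every tile is saturated at `s`, and
contracting inverts spreading. -/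
theorem exists_growth_eq (hT : IsDyckTiling lo up₂ T) (hc : IsCoverInclusive lo T)
    (h : IsEligible lo T s) (hmin : ∀ s' < s, ¬ IsEligible lo T s') :
    ∃ up T₀, IsDyckTiling (erasePeak lo s) up T₀ ∧ IsCoverInclusive (erasePeak lo s) T₀ ∧
      growth s up T₀ = T := by
  obtain ⟨up, hb, g⟩ := exists_isGrowth_of_isEligible hT hc h hmin
  have hs := h.peak
  set S : Finset (Finset Box) := (stripBoxes s up).image fun p => {p} with hS
  have strip_mem : ∀ p ∈ stripBoxes s up, {p} ∈ T := fun p hp =>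
    singleton_mem_of_mem_strip hT hc g hs.lt hmin hp
  have region : ∀ t ∈ T \ S, ∀ p ∈ t, collapse s p ∈ skewShape (erasePeak lo s) up := by
    intro t ht p hp
    rw [Finset.mem_sdiff] at ht
    refine ((mem_skewShape_growth hs hb g).1 (hT.mem_skewShape ht.1 hp)).resolve_right fun hp' => ?_
    refine ht.2 (Finset.mem_image.2 ⟨p, hp', ?_⟩)
    exact hT.eq_of_mem (strip_mem p hp') ht.1 (Finset.mem_singleton_self p) hp
  have tile_of : ∀ q, collapse s q ∈ skewShape (erasePeak lo s) up → ∃ t ∈ T \ S, q ∈ t := by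
    intro q hq
    obtain ⟨t, ht, hqt⟩ := hT.exists_mem_iff.2 ((mem_skewShape_growth hs hb g).2 (Or.inl hq))
    refine ⟨t, Finset.mem_sdiff.2 ⟨ht, fun hS' => ?_⟩, hqt⟩
    obtain ⟨p, hp, rfl⟩ := Finset.mem_image.1 hS'
    rw [Finset.mem_singleton] at hqt
    subst hqt
    exact collapse_not_mem_of_mem_strip hb hp hq
  have saturated : ∀ t ∈ T \ S, IsSaturated s t := by
    intro t ht y
    have htT := (Finset.mem_sdiff.1 ht).1
    -- The direction that eligibility does not give: outside the strip, both boxes collapse to the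
    -- same box, so the second one is tiled, and its tile contains the first by eligibility.
    have key : (s, y) ∈ t → (s + 1, y + 1) ∈ t := by
      intro hy
      have h1 := region t ht _ hy
      obtain ⟨u, hu, h2⟩ := tile_of (s + 1, y + 1) (by simpa [collapse] using h1)
      have huT := (Finset.mem_sdiff.1 hu).1
      rwa [hT.eq_of_mem htT huT hy (h.left u huT y h2)]
    refine ⟨⟨key, h.left t htT y⟩, ⟨fun hy => (h.right t htT y).1 (key hy), fun hy => ?_⟩⟩
    exact h.left t htT y ((h.right t htT y).2 hy)
  refine ⟨up, (T \ S).image (contract s), ?_, ?_, ?_⟩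
  · rw [isDyckTiling_iff]
    refine ⟨hb, ?_, ?_, ?_⟩
    · rw [Finset.forall_mem_image]
      exact fun t ht => (hT.tile t (Finset.mem_sdiff.1 ht).1).contract (saturated t ht)
    · intro t₁ h₁ t₂ h₂ p p₁ p₂
      obtain ⟨u₁, hu₁, rfl⟩ := Finset.mem_image.1 h₁
      obtain ⟨u₂, hu₂, rfl⟩ := Finset.mem_image.1 h₂
      rw [mem_contract] at p₁ p₂
      rw [hT.eq_of_mem (Finset.mem_sdiff.1 hu₁).1 (Finset.mem_sdiff.1 hu₂).1 p₁ p₂]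
    · intro p
      constructor
      · rintro ⟨t, ht, hp⟩
        obtain ⟨u, hu, rfl⟩ := Finset.mem_image.1 ht
        rw [← collapse_skipColumns s p]
        exact region u hu _ (mem_contract.1 hp)
      · intro hp
        rw [← collapse_skipColumns s p] at hp
        obtain ⟨t, ht, hpt⟩ := tile_of _ hp
        exact ⟨_, Finset.mem_image_of_mem _ ht, mem_contract.2 hpt⟩
  · rw [isCoverInclusive_iff] at hc ⊢
    rw [Finset.forall_mem_image]
    intro t ht
    have htT := (Finset.mem_sdiff.1 ht).1
    rcases hc t htT with hlow | ⟨u, hu, hne, hut⟩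
    · left
      intro p hp
      have := hlow _ (mem_contract.1 hp)
      rwa [collapse_height hs, collapse_skipColumns] at this
    · right
      -- A strip box is the top box of its column, so it cannot be the downward translate of a box
      -- of `t`.
      have huS : u ∈ T \ S := by
        refine Finset.mem_sdiff.2 ⟨hu, fun huS => ?_⟩
        obtain ⟨p, hp, rfl⟩ := Finset.mem_image.1 huS
        obtain ⟨q, hq⟩ := (hT.tile t htT).nonempty
        have hqp := hut q hq
        rw [Finset.mem_singleton] at hqp
        obtain ⟨i, hi, e1, h1, h2⟩ := mem_stripBoxes.1 (show (p.1, p.2) ∈ stripBoxes s up from hp)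
        rw [← hqp] at e1 h2
        dsimp only at e1 h2
        have hq' := hT.mem_skewShape htT (show (q.1, q.2) ∈ t from hq)
        rw [mem_skewShape hT.below, e1, g.left i hi.le] at hq'
        have := (isDyckFun_height up).step i (by
          have := g.semilength
          have := hT.below.1
          have := hs.lt
          omega)
        omega
      refine ⟨_, Finset.mem_image_of_mem _ huS, ?_, ?_⟩
      · intro e
        apply hne
        rw [← (saturated u huS).spread_contract, e, (saturated t ht).spread_contract]
      · intro p hp
        rw [mem_contract] at hp ⊢
        exact hut _ hp
  · have e1 : ((T \ S).image (contract s)).image (spread s) = T \ S := by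
      rw [Finset.image_image]
      conv_rhs => rw [← Finset.image_id (s := T \ S)]
      exact Finset.image_congr fun t ht => (saturated t ht).spread_contract
    rw [growth, e1, ← hS]
    refine Finset.sdiff_union_of_subset fun t ht => ?_
    obtain ⟨p, hp, rfl⟩ := Finset.mem_image.1 ht
    exact strip_mem p hp

end

/-! ### The generating function of the tilings -/

theorem tilingsAbove_zero : tilingsAbove 0 = {∅} := by
  ext T
  rw [mem_tilingsAbove, Finset.mem_singleton]
  constructor
  · rintro ⟨up, hT, -⟩
    refine Finset.eq_empty_of_forall_notMem fun t ht => ?_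
    obtain ⟨⟨x, y⟩, hp⟩ := (hT.tile t ht).nonempty
    have := hT.mem_skewShape ht hp
    rw [mem_skewShape hT.below, (isDyckFun_height up).tail x (by rw [← hT.below.1]; simp),
      (isDyckFun_height 0).tail x (by simp)] at this
    omega
  · rintro rfl
    have hb : LiesBelow 0 0 := ⟨rfl, fun _ => le_rfl⟩
    refine ⟨0, isDyckTiling_iff.2 ⟨hb, by simp, by simp, fun p => ?_⟩, by simp [IsCoverInclusive]⟩
    obtain ⟨x, y⟩ := p
    rw [mem_skewShape hb]
    simp
    omega

theorem sum_growth {lo : DyckWord} {s : ℕ} (hs : IsPeak lo s) [DecidablePred fun T =>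
    IsEligible lo T s ∧ ∀ s' < s, ¬ IsEligible lo T s'] :
    ∑ T ∈ (tilingsAbove lo).filter (fun T => IsEligible lo T s ∧ ∀ s' < s, ¬ IsEligible lo T s'),
      (X : ℤ[X]) ^ art T = X ^ (lo.toList.take s).count D *
        ∑ T ∈ tilingsAbove (erasePeak lo s), X ^ art T := by
  have choose_up : ∀ T ∈ tilingsAbove (erasePeak lo s), ∃ up, IsDyckTiling (erasePeak lo s) up T ∧
      IsCoverInclusive (erasePeak lo s) T := fun T hT => mem_tilingsAbove.1 hT
  choose up hup using choose_up
  rw [Finset.mul_sum]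
  symm
  refine Finset.sum_bij (fun T hT => growth s (up T hT) T) ?_ ?_ ?_ ?_
  · intro T hT
    have h := hup T hT
    have hle : s ≤ 2 * (up T hT).semilength := by
      have := h.1.below.1
      have := hs.semilength_erasePeak
      have := hs.lt
      omega
    obtain ⟨w, g⟩ := exists_isGrowth hle
    rw [Finset.mem_filter, mem_tilingsAbove]
    exact ⟨⟨w, h.1.growth hs g, h.2.growth hs h.1⟩, isEligible_growth hs,
      fun s' hs' => not_isEligible_growth hs h.1 hs'⟩
  · intro T hT T' hT' h
    exact growth_injective hs (hup T hT).1 (hup T' hT').1 h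
  · intro T hT
    rw [Finset.mem_filter, mem_tilingsAbove] at hT
    obtain ⟨⟨w, hw, hc⟩, he, hmin⟩ := hT
    obtain ⟨u, T₀, h1, h2, h3⟩ := exists_growth_eq hw hc he hmin
    have h0 := mem_tilingsAbove.2 ⟨u, h1, h2⟩
    refine ⟨T₀, h0, ?_⟩
    rw [(hup T₀ h0).1.up_unique h1]
    exact h3
  · intro T hT
    rw [art_growth hs (hup T hT).1, pow_add]

/-- The tilings are sorted by their leftmost eligible peak. -/
theorem sum_tilingsAbove {lo : DyckWord} (hlo : lo ≠ 0) :
    ∑ T ∈ tilingsAbove lo, (X : ℤ[X]) ^ art T = ∑ s ∈ peaks lo,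
      X ^ (lo.toList.take s).count D * ∑ T ∈ tilingsAbove (erasePeak lo s), X ^ art T := by
  classical
  have key : tilingsAbove lo = (peaks lo).biUnion fun s => (tilingsAbove lo).filter fun T =>
      IsEligible lo T s ∧ ∀ s' < s, ¬ IsEligible lo T s' := by
    ext T
    simp only [Finset.mem_biUnion, Finset.mem_filter, mem_peaks]
    constructor
    · intro hT
      obtain ⟨up, h, hc⟩ := mem_tilingsAbove.1 hT
      have hex := exists_isEligible h hc hlo
      exact ⟨Nat.find hex, (Nat.find_spec hex).peak, hT, Nat.find_spec hex,
        fun s' hs' => Nat.find_min hex hs'⟩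
    · rintro ⟨s, -, hT, -⟩
      exact hT
  conv_lhs => rw [key]
  rw [Finset.sum_biUnion]
  · exact Finset.sum_congr rfl fun s hs => sum_growth (mem_peaks.1 hs)
  · intro s _ s' _ hne
    refine Finset.disjoint_left.2 fun T h h' => ?_
    rw [Finset.mem_filter] at h h'
    rcases lt_or_gt_of_ne hne with hlt | hlt
    · exact h'.2.2 s hlt h.2.1
    · exact h.2.2 s' hlt h'.2.1

theorem sum_tilingsAbove_eq_lsGenFun (lo : DyckWord) :
    ∑ T ∈ tilingsAbove lo, (X : ℤ[X]) ^ art T = lsGenFun lo 1 0 := by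
  induction hn : lo.semilength generalizing lo with
  | zero =>
    obtain rfl : lo = 0 := DyckWord.toList_eq_nil.1
      (List.eq_nil_of_length_eq_zero (by rw [length_toList, hn]))
    simp [tilingsAbove_zero, art, area]
  | succ n ih =>
    have hlo : lo ≠ 0 := by
      rintro rfl
      simp at hn
    rw [sum_tilingsAbove hlo, lsGenFun_one_zero hlo]
    refine Finset.sum_congr rfl fun s hs => ?_
    rw [ih]
    have := (mem_peaks.1 hs).semilength_erasePeak
    omega

end DyckKL

theorem mainTheorem1 (lam : DyckWord) :
    ∑ T ∈ DyckKL.tilingsAbove lam, (Polynomial.X : Polynomial ℤ) ^ DyckKL.art T =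
      DyckKL.lsPolynomial lam (List.replicate (2 * lam.semilength) DyckStep.U) := by
  rw [DyckKL.sum_tilingsAbove_eq_lsGenFun, DyckKL.lsPolynomial_replicate]
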